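/- Let $K$ be a field of characteristic $0$ (for instance $\mathbb{R}$ or $\mathbb{C}$), let $\mathfrak{g}$ be a Lie algebra over $K$ of arbitrary, possibly infinite, dimension, and let $z \in K$. Let $\mathrm{Sym}(\mathfrak{g}) = \bigoplus_n \mathrm{Sym}^n(\mathfrak{g})$ be the symmetric algebra, with projections $\pi_n$ onto $\mathrm{Sym}^n(\mathfrak{g})$, and let $\mathfrak{g}_z$ be the vector space $\mathfrak{g}$ with the rescaled bracket $z[\cdot,\cdot]$. Let $\mathfrak{q} \colon \mathrm{Sym}(\mathfrak{g}) \to U(\mathfrak{g})$ and $\mathfrak{q}_z \colon \mathrm{Sym}(\mathfrak{g}) \to U(\mathfrak{g}_z)$ be the symmetrization maps $$\xi_1 \cdots \xi_n \longmapsto \frac{1}{n!} \sum_{\sigma \in S_n} \xi_{\sigma(1)} \odot \cdots \odot \xi_{\sigma(n)}$$ into the universal enveloping algebras. Then $\mathfrak{q}$ and $\mathfrak{q}_z$ are bijective. Let the Gutt star product $\star_z$ be the bilinear product on $\mathrm{Sym}(\mathfrak{g})$ such that, for $x \in \mathrm{Sym}^k(\mathfrak{g})$ and $y \in \mathrm{Sym}^\ell(\mathfrak{g})$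 with $k + \ell \geq 1$, $$x \star_z y = \sum_{n=0}^{k+\ell-1} z^n \, \pi_{k+\ell-n}\bigl(\mathfrak{q}^{-1}(\mathfrak{q}(x) \odot \mathfrak{q}(y))\bigr),$$ and $1 \star_z 1 = 1$. Then the following hold. 1. For all $x, y \in \mathrm{Sym}(\mathfrak{g})$ one has $x \star_z y = \mathfrak{q}_z^{-1}(\mathfrak{q}_z(x) \odot_z \mathfrak{q}_z(y))$, where $\odot_z$ is the product of $U(\mathfrak{g}_z)$. 2. There is exactly one bilinear product $\ast_z$ on $\mathrm{Sym}(\mathfrak{g})$ (Drinfel'd's product) with $$\exp(\xi) \ast_z \exp(\eta) = \exp\Bigl(\tfrac{1}{z} \mathrm{BCH}(z\xi, z\eta)\Bigr) \qquad \text{for all } \xi, \eta \in \mathfrak{g}$$ as formal power series in $\xi$ and $\eta$ (that is, the parts of degree $a$ in $\xi$ and $b$ in $\eta$ agree for all $a, b \geq 0$), and it is $\star_z$. Here $\tfrac{1}{z}\mathrm{BCH}(z\xi,z\eta) = \sum_{a+b\geq 1} z^{a+b-1} \mathrm{BCH}_{a,b}(\xi,\eta)$, also for $z = 0$, where $\mathrm{BCH}_{a,b}(\xi,\eta)$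 is the part of the Baker--Campbell--Hausdorff series $\mathrm{BCH}(\xi,\eta)$ of degree $a$ in $\xi$ and $b$ in $\eta$. 3. For all $\xi, \eta \in \mathfrak{g}$ and $k \geq 0$, $$\xi^k \star_z \eta = \sum_{j=0}^{k} \binom{k}{j} z^j B_j^* \, \xi^{k-j} (\mathrm{ad}_\xi)^j(\eta), \qquad \text{where } \frac{t}{1 - e^{-t}} = \sum_{j=0}^\infty \frac{B_j^*}{j!} t^j.$$ -/

import Mathlib

noncomputable section

namespace GuttStar

/-! ### The grading of the symmetric algebra -/

section Grading

variable (K : Type*) [Field K] {V : Type*} [AddCommGroup V] [Module K V]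

/-- The algebra morphism `Sym(V) → Sym(V)[X]` with `ξ ↦ ξ X` for `ξ ∈ V`; the coefficient of
`X ^ n` in the image of `x` is the homogeneous part of `x` of degree `n`. -/
def grade : SymmetricAlgebra K V →ₐ[K] Polynomial (SymmetricAlgebra K V) :=
  SymmetricAlgebra.lift
    (((Polynomial.monomial 1 :
        SymmetricAlgebra K V →ₗ[SymmetricAlgebra K V] Polynomial (SymmetricAlgebra K V)).restrictScalars
          K) ∘ₗ SymmetricAlgebra.ι K V)

/-- The projection `π_n` of `Sym(V)` onto its homogeneous part of degree `n`. -/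
def homPart (n : ℕ) : SymmetricAlgebra K V →ₗ[K] SymmetricAlgebra K V :=
  ((Polynomial.lcoeff (SymmetricAlgebra K V) n).restrictScalars K) ∘ₗ (grade K).toLinearMap

theorem homPart_apply (n : ℕ) (x : SymmetricAlgebra K V) :
    homPart K n x = (grade K x).coeff n := rfl

theorem grade_ι (v : V) :
    grade K (SymmetricAlgebra.ι K V v) = Polynomial.monomial 1 (SymmetricAlgebra.ι K V v) := by
  simp [grade]

theorem grade_prod_ι (l : List V) :
    grade K (l.map (SymmetricAlgebra.ι K V)).prod
      = Polynomial.monomial l.length (l.map (SymmetricAlgebra.ι K V)).prod := by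
  induction l with
  | nil => simp
  | cons v l ih =>
    simp only [List.map_cons, List.prod_cons, map_mul, ih, grade_ι, Polynomial.monomial_mul_monomial,
      List.length_cons, add_comm]

/-- `π_n` is the identity on products of `n` elements of `V` and kills products of any other
number of elements. -/
theorem homPart_prod_ι (n : ℕ) (l : List V) :
    homPart K n (l.map (SymmetricAlgebra.ι K V)).prod
      = if l.length = n then (l.map (SymmetricAlgebra.ι K V)).prod else 0 := by
  rw [homPart_apply, grade_prod_ι, Polynomial.coeff_monomial]

end Grading

/-! ### Symmetrization -/

section Symmetrization

variable {K : Type*} [Field K] {V : Type*} [AddCommGroup V] [Module K V]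
variable {A : Type*} [Ring A] [Algebra K A] (f : V →ₗ[K] A)

/-- The multilinear map `(ξ₁, …, ξₙ) ↦ (1/n!) ∑_{σ ∈ Sₙ} f ξ_{σ(1)} ⋯ f ξ_{σ(n)}`. -/
def symmMulti (n : ℕ) : MultilinearMap K (fun _ : Fin n => V) A :=
  (n.factorial : K)⁻¹ • ∑ σ : Equiv.Perm (Fin n),
    ((MultilinearMap.mkPiAlgebraFin K n A).compLinearMap (fun _ => f)).domDomCongr σ

theorem symmMulti_apply (n : ℕ) (v : Fin n → V) :
    symmMulti f n v
      = (n.factorial : K)⁻¹ • ∑ σ : Equiv.Perm (Fin n), (List.ofFn fun i => f (v (σ i))).prod := by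
  simp [symmMulti]

theorem symmMulti_perm (n : ℕ) (v : Fin n → V) (τ : Equiv.Perm (Fin n)) :
    symmMulti f n (fun i => v (τ i)) = symmMulti f n v := by
  rw [symmMulti_apply, symmMulti_apply]
  congr 1
  exact Fintype.sum_equiv (Equiv.mulLeft τ) _ _ (fun σ => rfl)

/-- Symmetrization on the tensor algebra. -/
def symmTensor : TensorAlgebra K V →ₗ[K] A :=
  (DirectSum.toModule K ℕ A fun n => PiTensorProduct.lift (symmMulti f n)) ∘ₗ
    (TensorAlgebra.equivDirectSum (R := K) (M := V)).toLinearMap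

theorem symmTensor_tprod (n : ℕ) (v : Fin n → V) :
    symmTensor f (TensorAlgebra.tprod K V n v) = symmMulti f n v := by
  have h : (TensorAlgebra.equivDirectSum (R := K) (M := V)) (TensorAlgebra.tprod K V n v)
      = DirectSum.lof K ℕ (fun n => PiTensorProduct K (fun _ : Fin n => V)) n
          (PiTensorProduct.tprod K v) := by
    rw [TensorAlgebra.equivDirectSum_apply, TensorAlgebra.toDirectSum_tensorPower_tprod]
    rfl
  simp only [symmTensor, LinearMap.comp_apply, AlgEquiv.toLinearMap_apply, h,
    DirectSum.toModule_lof, PiTensorProduct.lift.tprod]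

theorem symmTensor_list (l : List V) :
    symmTensor f (l.map (TensorAlgebra.ι K)).prod = symmMulti f l.length l.get := by
  rw [← symmTensor_tprod, TensorAlgebra.tprod_apply]
  congr 2
  conv_lhs => rw [← List.ofFn_get l, List.map_ofFn]
  rfl

theorem symmMulti_equiv {n m : ℕ} (e : Fin n ≃ Fin m) (v : Fin m → V) :
    symmMulti f n (fun i => v (e i)) = symmMulti f m v := by
  have h : n = m := by simpa using Fintype.card_congr e
  subst h
  exact symmMulti_perm f n v e

theorem symmMulti_list_perm {l l' : List V} (h : l.Perm l') :
    symmMulti f l.length l.get = symmMulti f l'.length l'.get := by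
  classical
  rw [← symmMulti_equiv f
    ⟨h.idxBij, h.symm.idxBij, h.idxBij_rightInverse_idxBij_symm,
      h.idxBij_leftInverse_idxBij_symm⟩ l'.get]
  congr 1
  funext i
  exact (h.getElem_idxBij_eq_getElem i).symm

theorem tensor_list_induction {p : TensorAlgebra K V → Prop}
    (list : ∀ l : List V, p (l.map (TensorAlgebra.ι K)).prod)
    (add : ∀ a b, p a → p b → p (a + b)) (smul : ∀ (r : K) a, p a → p (r • a))
    (t : TensorAlgebra K V) : p t := by
  have hspan : t ∈ Submodule.span K
      (Set.range fun l : List V => (l.map (TensorAlgebra.ι K)).prod) := by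
    have hmul : ∀ a b : TensorAlgebra K V,
        a ∈ Submodule.span K (Set.range fun l : List V => (l.map (TensorAlgebra.ι K)).prod) →
        b ∈ Submodule.span K (Set.range fun l : List V => (l.map (TensorAlgebra.ι K)).prod) →
        a * b ∈ Submodule.span K
          (Set.range fun l : List V => (l.map (TensorAlgebra.ι K)).prod) := by
      intro a b ha hb
      have := Submodule.mul_mem_mul ha hb
      rw [Submodule.span_mul_span] at this
      refine Submodule.span_mono ?_ this
      rintro _ ⟨_, ⟨l, rfl⟩, _, ⟨l', rfl⟩, rfl⟩
      exact ⟨l ++ l', by simp⟩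
    induction t using TensorAlgebra.induction with
    | algebraMap r =>
      rw [Algebra.algebraMap_eq_smul_one]
      exact Submodule.smul_mem _ _ (Submodule.subset_span ⟨[], by simp⟩)
    | ι v => exact Submodule.subset_span ⟨[v], by simp⟩
    | mul a b ha hb => exact hmul a b ha hb
    | add a b ha hb => exact Submodule.add_mem _ ha hb
  induction hspan using Submodule.span_induction with
  | mem _ h => obtain ⟨l, rfl⟩ := h; exact list l
  | zero => simpa using smul 0 _ (list [])
  | add a b _ _ ha hb => exact add a b ha hb
  | smul r a _ ha => exact smul r a ha

theorem symmTensor_swap (a b : TensorAlgebra K V) (x y : V) :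
    symmTensor f (a * (TensorAlgebra.ι K x * TensorAlgebra.ι K y) * b)
      = symmTensor f (a * (TensorAlgebra.ι K y * TensorAlgebra.ι K x) * b) := by
  induction a using tensor_list_induction with
  | add a a' ha ha' => simp only [add_mul, map_add, ha, ha']
  | smul r a ha => simp only [smul_mul_assoc, map_smul, ha]
  | list l =>
    induction b using tensor_list_induction with
    | add a a' ha ha' => simp only [mul_add, map_add, ha, ha']
    | smul r a ha => simp only [mul_smul_comm, map_smul, ha]
    | list l' =>
      have key : ∀ x y : V, (l.map (TensorAlgebra.ι K)).prod *
          (TensorAlgebra.ι K x * TensorAlgebra.ι K y) * (l'.map (TensorAlgebra.ι K)).prod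
          = ((l ++ x :: y :: l').map (TensorAlgebra.ι K)).prod := by
        intro x y
        simp [mul_assoc]
      rw [key, key, symmTensor_list, symmTensor_list]
      exact symmMulti_list_perm f ((List.Perm.swap y x l').append_left l)

/-- Two tensors are related if they have the same symmetrization in every context. -/
def symmCon : RingCon (TensorAlgebra K V) where
  r a b := ∀ c d, symmTensor f (c * a * d) = symmTensor f (c * b * d)
  iseqv := ⟨fun _ _ _ => rfl, fun h c d => (h c d).symm, fun h h' c d => (h c d).trans (h' c d)⟩
  add' h h' c d := by simp only [mul_add, add_mul, map_add, h c d, h' c d]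
  mul' {a b a' b'} h h' c d := by
    have h1 := h c (a' * d)
    have h2 := h' (c * b) d
    simp only [mul_assoc] at h1 h2 ⊢
    rw [h1, h2]

theorem symRingCon_le_symmCon : TensorAlgebra.symRingCon K V ≤ symmCon f := by
  refine RingCon.ringConGen_le.2 ?_
  rintro _ _ ⟨x, y⟩ c d
  exact symmTensor_swap f c d x y

theorem ker_algHom_le_ker_symmTensor :
    LinearMap.ker (SymmetricAlgebra.algHom K V).toLinearMap ≤ LinearMap.ker (symmTensor f) := by
  intro a ha
  have h : SymmetricAlgebra.algHom K V a = SymmetricAlgebra.algHom K V 0 := by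
    simpa using ha
  have h' := symRingCon_le_symmCon f (Quotient.exact h) 1 1
  simpa using h'

/-- The symmetrization map `Sym(V) → A` of a linear map `f : V → A` into an associative algebra:
`ξ₁ ⋯ ξₙ ↦ (1/n!) ∑_{σ ∈ Sₙ} f ξ_{σ(1)} ⋯ f ξ_{σ(n)}` (see `symmetrization_prod`). -/
def symmetrization : SymmetricAlgebra K V →ₗ[K] A :=
  (LinearMap.ker (SymmetricAlgebra.algHom K V).toLinearMap).liftQ (symmTensor f)
      (ker_algHom_le_ker_symmTensor f) ∘ₗ
    ((SymmetricAlgebra.algHom K V).toLinearMap.quotKerEquivOfSurjective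
      (SymmetricAlgebra.algHom_surjective K V)).symm.toLinearMap

theorem symmetrization_algHom (t : TensorAlgebra K V) :
    symmetrization f (SymmetricAlgebra.algHom K V t) = symmTensor f t := by
  have h : ((SymmetricAlgebra.algHom K V).toLinearMap.quotKerEquivOfSurjective
      (SymmetricAlgebra.algHom_surjective K V)).symm (SymmetricAlgebra.algHom K V t)
      = Submodule.Quotient.mk t := by
    rw [LinearEquiv.symm_apply_eq]
    rfl
  simp only [symmetrization, LinearMap.comp_apply, LinearEquiv.coe_coe, h]
  rfl

theorem symmetrization_prod (n : ℕ) (v : Fin n → V) :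
    symmetrization f (∏ i, SymmetricAlgebra.ι K V (v i))
      = (n.factorial : K)⁻¹ • ∑ σ : Equiv.Perm (Fin n),
          (List.ofFn fun i => f (v (σ i))).prod := by
  have h : ∏ i, SymmetricAlgebra.ι K V (v i)
      = SymmetricAlgebra.algHom K V (TensorAlgebra.tprod K V n v) := by
    rw [TensorAlgebra.tprod_apply, map_list_prod, List.map_ofFn, List.prod_ofFn]
    rfl
  rw [h, symmetrization_algHom, symmTensor_tprod, symmMulti_apply]

end Symmetrization

/-! ### The quantization maps and the two products defined by symmetrization -/

section Lie

variable (K : Type*) [Field K] {g : Type*} [LieRing g] [LieAlgebra K g]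

/-- The Lie algebra `g_z`: the vector space `g` with the rescaled bracket `z [ξ, η]`. -/
def Rescaled {K : Type*} (_z : K) (g : Type*) : Type _ := g

instance (z : K) : AddCommGroup (Rescaled z g) := inferInstanceAs (AddCommGroup g)

instance (z : K) : Module K (Rescaled z g) := inferInstanceAs (Module K g)

/-- The identity map `g → g_z`, as a map of vector spaces. -/
def toRescaled (z : K) : g ≃ₗ[K] Rescaled z g := LinearEquiv.refl K g

instance (z : K) : LieRing (Rescaled z g) where
  bracket x y := toRescaled K z (z • ⁅(toRescaled K z).symm x, (toRescaled K z).symm y⁆)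
  add_lie x y w := by simp
  lie_add x y w := by simp
  lie_self x := by simp
  leibniz_lie x y w := by
    simp only [LinearEquiv.symm_apply_apply, lie_smul, smul_lie, ← map_add, ← smul_add]
    rw [leibniz_lie ((toRescaled K z).symm x)]

instance (z : K) : LieAlgebra K (Rescaled z g) where
  lie_smul t x y := by
    change toRescaled K z (z • ⁅(toRescaled K z).symm x, (toRescaled K z).symm (t • y)⁆)
      = t • toRescaled K z (z • ⁅(toRescaled K z).symm x, (toRescaled K z).symm y⁆)
    rw [LinearEquiv.map_smul (toRescaled K z).symm, lie_smul, smul_comm, LinearEquiv.map_smul]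

theorem rescaled_bracket (z : K) (ξ η : g) :
    ⁅toRescaled K z ξ, toRescaled K z η⁆ = toRescaled K z (z • ⁅ξ, η⁆) := rfl

attribute [local instance 100] LieRing.ofAssociativeRing

/-- The quantization map `q : Sym(g) → U(g)`,
`ξ₁ ⋯ ξₙ ↦ (1/n!) ∑_{σ ∈ Sₙ} ξ_{σ(1)} ⊙ ⋯ ⊙ ξ_{σ(n)}`. -/
def quant (g : Type*) [LieRing g] [LieAlgebra K g] :
    SymmetricAlgebra K g →ₗ[K] UniversalEnvelopingAlgebra K g :=
  symmetrization (UniversalEnvelopingAlgebra.ι K : g →ₗ⁅K⁆ UniversalEnvelopingAlgebra K g).toLinearMap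

/-- The quantization map `q_z : Sym(g) → U(g_z)`. -/
def quantRescaled (g : Type*) [LieRing g] [LieAlgebra K g] (z : K) :
    SymmetricAlgebra K g →ₗ[K] UniversalEnvelopingAlgebra K (Rescaled z g) :=
  symmetrization
    ((UniversalEnvelopingAlgebra.ι K :
        Rescaled z g →ₗ⁅K⁆ UniversalEnvelopingAlgebra K (Rescaled z g)).toLinearMap ∘ₗ (toRescaled K z).toLinearMap)

open Classical in
/-- The inverse of a bijective linear map (by convention `0` if the map is not bijective). -/
def linearInverse {V W : Type*} [AddCommGroup V] [Module K V] [AddCommGroup W] [Module K W]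
    (f : V →ₗ[K] W) : W →ₗ[K] V :=
  if h : Function.Bijective f then (LinearEquiv.ofBijective f h).symm.toLinearMap else 0

/-- The pull-back `(x, y) ↦ f⁻¹ (f x · f y)` of the product of an algebra along a bijective linear
map `f`. -/
def pullbackMul {V A : Type*} [AddCommGroup V] [Module K V] [Ring A] [Algebra K A]
    (f : V →ₗ[K] A) : V →ₗ[K] V →ₗ[K] V :=
  ((LinearMap.mul K A).compl₁₂ f f).compr₂ (linearInverse K f)

/-- The deformed PBW star product `x ⋆̂_z y = q_z⁻¹ (q_z x ⊙_z q_z y)`. -/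
def pbwStar (z : K) :
    SymmetricAlgebra K g →ₗ[K] SymmetricAlgebra K g →ₗ[K] SymmetricAlgebra K g :=
  pullbackMul K (quantRescaled K g z)

/-- The formula `∑_{n=0}^{k+ℓ-1} z ^ n π_{k+ℓ-n} (q⁻¹ (q x ⊙ q y))` which is the Gutt star product of
`x ∈ Sym^k(g)` and `y ∈ Sym^ℓ(g)`. (For `k = ℓ = 0` the subtraction is truncated, and only the term
with `n = 0` is present.) -/
def guttHom (z : K) (k l : ℕ) :
    SymmetricAlgebra K g →ₗ[K] SymmetricAlgebra K g →ₗ[K] SymmetricAlgebra K g :=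
  ∑ n ∈ Finset.Icc 0 (k + l - 1), z ^ n • (pullbackMul K (quant K g)).compr₂ (homPart K (k + l - n))

theorem polynomial_sum_smul {R M : Type*} [Semiring R] [Algebra K R] [AddCommGroup M] [Module K M]
    (c : K) (p : Polynomial R) (f : ℕ → R → M) (h0 : ∀ n, f n 0 = 0)
    (hs : ∀ n a, f n (c • a) = c • f n a) : (c • p).sum f = c • p.sum f := by
  rw [Polynomial.sum_def,
    Finset.sum_subset (Polynomial.support_smul c p) (fun n _ hn => by
      rw [Polynomial.notMem_support_iff.1 hn, h0]),
    Polynomial.sum_def, Finset.smul_sum]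
  exact Finset.sum_congr rfl fun n _ => by rw [Polynomial.coeff_smul, hs]

/-- The Gutt star product `x ⋆_z y`: the bilinear extension of `guttHom` from homogeneous elements,
i.e. `x ⋆_z y = ∑_{k, ℓ} guttHom z k ℓ (π_k x) (π_ℓ y)`, a finite sum. -/
def guttStar (z : K) :
    SymmetricAlgebra K g →ₗ[K] SymmetricAlgebra K g →ₗ[K] SymmetricAlgebra K g :=
  LinearMap.mk₂ K
    (fun x y => (grade K x).sum fun k xk => (grade K y).sum fun l yl => guttHom K z k l xk yl)
    (fun x x' y => by
      rw [map_add]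
      refine Polynomial.sum_add_index _ _ _ (fun k => ?_) (fun k a b => ?_)
      · simp [Polynomial.sum]
      · simp [Polynomial.sum, Finset.sum_add_distrib])
    (fun c x y => by
      rw [map_smul]
      refine (polynomial_sum_smul K c (grade K x) _ (fun k => ?_) (fun k a => ?_))
      · simp [Polynomial.sum]
      · simp [Polynomial.sum, Finset.smul_sum])
    (fun x y y' => by
      simp only [map_add]
      rw [← Polynomial.sum_add]
      congr 1
      funext k a
      exact Polynomial.sum_add_index _ _ _ (fun l => by simp) (fun l a b => by simp))
    (fun c x y => by
      simp only [map_smul]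
      rw [Polynomial.smul_sum]
      congr 1
      funext k a
      exact polynomial_sum_smul K c (grade K y) _ (fun l => by simp) (fun l a => by simp))

theorem guttStar_apply (z : K) (x y : SymmetricAlgebra K g) :
    guttStar K z x y
      = ∑ k ∈ (grade K x).support, ∑ l ∈ (grade K y).support,
          guttHom K z k l (homPart K k x) (homPart K l y) := rfl

end Lie

/-! ### The Baker-Campbell-Hausdorff series and Drinfel'd's star product -/

section Drinfeld

variable (K : Type*) [Field K] {g : Type*} [LieRing g] [LieAlgebra K g]

/-- The nested bracket `[x₁, [x₂, … [x_{n-1}, x_n] … ]]` of a word. -/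
def nestedBracket : List g → g
  | [] => 0
  | [x] => x
  | x :: y :: l => ⁅x, nestedBracket (y :: l)⁆

/-- The word `ξ^{r₁} η^{s₁} ⋯ ξ^{r_m} η^{s_m}`. -/
def bchWord (ξ η : g) {m : ℕ} (r s : Fin m → ℕ) : List g :=
  (List.ofFn fun i => List.replicate (r i) ξ ++ List.replicate (s i) η).flatten

/-- `BCH_{a,b}(ξ, η)`, the part of the Baker-Campbell-Hausdorff series `log (exp ξ exp η)` which
contains `a` times the letter `ξ` and `b` times the letter `η`, in Dynkin's form
`∑_m ((-1)^{m-1} / m) ∑ [ξ^{r₁} η^{s₁} ⋯ ξ^{r_m} η^{s_m}] / ((a + b) ∏ᵢ rᵢ! sᵢ!)`, where the inner sum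
is over all `r, s` with `rᵢ + sᵢ ≥ 1`, `∑ rᵢ = a`, `∑ sᵢ = b`. -/
def bch (a b : ℕ) (ξ η : g) : g :=
  ∑ m ∈ Finset.Icc 1 (a + b),
    ∑ p ∈ (Finset.Nat.antidiagonalTuple m a ×ˢ Finset.Nat.antidiagonalTuple m b).filter
        (fun p => ∀ i, 1 ≤ p.1 i + p.2 i),
      ((-1 : K) ^ (m - 1) / (m * (a + b) * ∏ i, ((p.1 i).factorial * (p.2 i).factorial))) •
        nestedBracket (bchWord ξ η p.1 p.2)

theorem nestedBracket_map_smul (z : K) (l : List g) :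
    nestedBracket (l.map (z • ·)) = z ^ l.length • nestedBracket l := by
  induction l with
  | nil => simp [nestedBracket]
  | cons x l ih =>
    cases l with
    | nil => simp [nestedBracket]
    | cons y l =>
      simp only [List.map_cons, nestedBracket, List.length_cons] at ih ⊢
      rw [ih, smul_lie, lie_smul, smul_smul, ← pow_succ']

theorem bch_smul (z : K) (a b : ℕ) (ξ η : g) :
    bch K a b (z • ξ) (z • η) = z ^ (a + b) • bch K a b ξ η := by
  simp only [bch, Finset.smul_sum]
  refine Finset.sum_congr rfl fun m _ => Finset.sum_congr rfl fun p hp => ?_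
  simp only [Finset.mem_filter, Finset.mem_product, Finset.Nat.mem_antidiagonalTuple] at hp
  have hw : bchWord (z • ξ) (z • η) p.1 p.2 = (bchWord ξ η p.1 p.2).map (z • ·) := by
    simp [bchWord, List.map_flatten, List.map_ofFn, Function.comp_def]
  have hl : (bchWord ξ η p.1 p.2).length = ∑ i, p.1 i + ∑ i, p.2 i := by
    simp [bchWord, List.length_flatten, List.map_ofFn, Function.comp_def, List.sum_ofFn,
      Finset.sum_add_distrib]
  rw [hw, nestedBracket_map_smul, hl, hp.1.1, hp.1.2, smul_comm]

/-- Formal power series with coefficients in `Sym(g)` in two commuting variables `X 0` and `X 1`,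
which keep track of the degrees in `ξ` and in `η`. -/
abbrev FormalSym (K : Type*) [Field K] (g : Type*) [LieRing g] [LieAlgebra K g] :=
  MvPowerSeries (Fin 2) (SymmetricAlgebra K g)

/-- The formal power series `(1/z) BCH(zξ, zη) = ∑_{(a,b) ≠ (0,0)} z^{a+b-1} BCH_{a,b}(ξ, η)`,
where `BCH_{a,b}(ξ, η)` is the coefficient of `X 0 ^ a * X 1 ^ b`. In this form it is defined for
`z = 0`, too. -/
def bchSeries (z : K) (ξ η : g) : FormalSym K g :=
  fun d => z ^ (d 0 + d 1 - 1) • SymmetricAlgebra.ι K g (bch K (d 0) (d 1) ξ η)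

/-- For `z ≠ 0`, the coefficients of `bchSeries` are those of `(1/z) BCH(zξ, zη)`. -/
theorem coeff_bchSeries {z : K} (hz : z ≠ 0) (ξ η : g) (d : Fin 2 →₀ ℕ) :
    MvPowerSeries.coeff d (bchSeries K z ξ η)
      = SymmetricAlgebra.ι K g (z⁻¹ • bch K (d 0) (d 1) (z • ξ) (z • η)) := by
  change z ^ (d 0 + d 1 - 1) • SymmetricAlgebra.ι K g (bch K (d 0) (d 1) ξ η) = _
  rw [bch_smul, smul_smul]
  rcases Nat.eq_zero_or_pos (d 0 + d 1) with h | h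
  · have h0 : d 0 = 0 := by omega
    have h1 : d 1 = 0 := by omega
    simp [h0, h1, bch]
  · obtain ⟨n, hn⟩ := Nat.exists_eq_add_of_lt h
    rw [hn]
    simp [pow_succ', hz]

theorem hasSubst_bchSeries (z : K) (ξ η : g) : PowerSeries.HasSubst (bchSeries K z ξ η) := by
  apply PowerSeries.HasSubst.of_constantCoeff_zero
  change z ^ _ • SymmetricAlgebra.ι K g (bch K 0 0 ξ η) = 0
  simp [bch]

theorem hasSubst_C_mul_X (ξ : g) (i : Fin 2) :
    PowerSeries.HasSubst
      (MvPowerSeries.C (SymmetricAlgebra.ι K g ξ) * MvPowerSeries.X i : FormalSym K g) := by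
  apply PowerSeries.HasSubst.of_constantCoeff_zero
  simp

/-- The exponential of a formal power series (with vanishing constant term). -/
def formalExp [CharZero K] (f : FormalSym K g) : FormalSym K g :=
  (PowerSeries.exp K).subst f

/-- The extension of a bilinear product of `Sym(g)` to formal power series, bilinear over the formal
variables. -/
def formalMul (D : SymmetricAlgebra K g →ₗ[K] SymmetricAlgebra K g →ₗ[K] SymmetricAlgebra K g)
    (f h : FormalSym K g) : FormalSym K g :=
  fun d => ∑ p ∈ Finset.HasAntidiagonal.antidiagonal d, D (MvPowerSeries.coeff p.1 f) (MvPowerSeries.coeff p.2 h)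

/-- The defining property of Drinfel'd's star product: a bilinear product `D` on `Sym(g)` with
`D (exp ξ) (exp η) = exp ((1/z) BCH(zξ, zη))` for all `ξ, η ∈ g`, as formal power series in `ξ`
and `η`. -/
def IsDrinfeldStar [CharZero K] (z : K)
    (D : SymmetricAlgebra K g →ₗ[K] SymmetricAlgebra K g →ₗ[K] SymmetricAlgebra K g) : Prop :=
  ∀ ξ η : g,
    formalMul K D
        (formalExp K (MvPowerSeries.C (SymmetricAlgebra.ι K g ξ) * MvPowerSeries.X 0))
        (formalExp K (MvPowerSeries.C (SymmetricAlgebra.ι K g η) * MvPowerSeries.X 1))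
      = formalExp K (bchSeries K z ξ η)

end Drinfeld

end GuttStar

end

/-! By polarization the powers $\xi^n$ span $\mathrm{Sym}(\mathfrak g)$ in characteristic $0$, so
linear and bilinear maps need only be compared on powers, where symmetrization is simply $\xi^n
\mapsto f(\xi)^n$. Everything then becomes an identity between generating series, with $B(t) =
t/(1-e^{-t})$ in the leading role.

Bijectivity of $\mathfrak q$ is proved without ordered bases. For injectivity, the expected formula
for $\xi \star \eta^k$ defines operators `leftAct` on $\mathrm{Sym}(\mathfrak g)$. They represent
$\mathfrak g$ because of an addition law for $B$ (`bern_identity`, `leftAct_lie`), and $u \mapsto u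
\cdot 1$ is then a left inverse of $\mathfrak q$. For surjectivity, write $L$ and $R$ for left and
right multiplication by $x = \xi$ in $U(\mathfrak g)$. The identity $B(L-R)\,\frac{e^L-e^R}{L-R} =
e^L$ expresses $\mathfrak q(\xi^k) \odot \eta$ as a symmetrization (`symmetrization_mul`), so the
image of $\mathfrak q$ is a right ideal containing $1$. The same computation gives the Bernoulli
formula for $\xi^k \star_z \eta$.

In that formula a term with $j$ brackets loses $j$ degrees and carries $z^j$. Hence weighting the
part of degree $i$ by $z^{d-i}$ turns the product for $z=1$ into the one pulled back from
$U(\mathfrak g_z)$ (`homogenize_mul_pow`), which is the first claim.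

For Drinfel'd's product, the BCH formula in Dynkin's form is proved in any associative algebra.
Applying the Euler derivation $E$ to $e^Z = e^x e^y$ gives $E Z = \frac{\log P}{P-1}\,(x +
e^{\mathrm{ad}\,x} y)$ with $P = e^{\mathrm{ad}\,x} e^{\mathrm{ad}\,y}$, and expanding in powers of
$P-1$ produces Dynkin's words (`elemEval_bch`). Symmetrization carries the exponential of a
$\mathfrak g$-valued series in $\mathrm{Sym}(\mathfrak g)$ to its exponential in $U(\mathfrak g_z)$.
So the defining equation says, degree by degree, that the product agrees with $\star_z$ on divided
powers, and these span. -/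

namespace GuttStar

noncomputable section

attribute [local instance 100] LieRing.ofAssociativeRing

open Finset.HasAntidiagonal (antidiagonal)

/-! ### Polarization: powers of vectors span the symmetric algebra -/

section Polarization

variable {K : Type*} [Field K]

/-- The coefficients of a polynomial function with values in a subspace lie in the subspace. -/
theorem coeff_mem_of_forall_sum_mem [CharZero K] {M : Type*} [AddCommGroup M] [Module K M]
    (W : Submodule K M) (n : ℕ) (c : ℕ → M) (h : ∀ t : K, ∑ i ∈ Finset.range n, t ^ i • c i ∈ W) (i : ℕ) (hi : i < n) :
    c i ∈ W := by
  -- Modulo `W`, every linear functional turns the sum into a scalar polynomial vanishing on the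
  -- infinite field $K$, hence with zero coefficients.
  rw [← Submodule.Quotient.mk_eq_zero, ← Module.forall_dual_apply_eq_zero_iff K]
  intro φ
  set p : Polynomial K := ∑ i ∈ Finset.range n,
    Polynomial.C (φ (Submodule.Quotient.mk (c i))) * Polynomial.X ^ i with hp
  have hp0 : p = 0 := by
    refine Polynomial.funext fun t => ?_
    have := congrArg φ ((Submodule.Quotient.mk_eq_zero W).2 (h t))
    rw [← Submodule.mkQ_apply] at this
    simp only [map_sum, map_smul, Submodule.mkQ_apply, map_zero, smul_eq_mul] at this
    simp only [hp, Polynomial.eval_finsetSum, Polynomial.eval_mul, Polynomial.eval_C,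
      Polynomial.eval_pow, Polynomial.eval_X, Polynomial.eval_zero]
    rw [← this]
    exact Finset.sum_congr rfl fun _ _ => mul_comm _ _
  have := congrArg (fun q => Polynomial.coeff q i) hp0
  simpa [hp, Polynomial.finsetSum_coeff, Polynomial.coeff_C_mul, Polynomial.coeff_X_pow, hi]
    using this

theorem coeff_eq_of_forall_sum_eq [CharZero K] {M : Type*} [AddCommGroup M] [Module K M]
    (n : ℕ) (c c' : ℕ → M)
    (h : ∀ t : K, ∑ i ∈ Finset.range n, t ^ i • c i = ∑ i ∈ Finset.range n, t ^ i • c' i)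
    (i : ℕ) (hi : i < n) : c i = c' i := by
  have := coeff_mem_of_forall_sum_mem (K := K) (⊥ : Submodule K M) n (fun i => c i - c' i)
    (fun t => by simp [smul_sub, h t]) i hi
  simpa [sub_eq_zero] using this

/-- The expansion of `(a + t b) ^ (n + 1)` in powers of `t`, up to first order. -/
theorem exists_add_smul_pow {A : Type*} [Ring A] [Algebra K A] (a b : A) (n : ℕ) :
    ∃ c : ℕ → A, c 0 = a ^ (n + 1) ∧ c 1 = ∑ p ∈ antidiagonal n, a ^ p.1 * b * a ^ p.2 ∧
      ∀ t : K, (a + t • b) ^ (n + 1) = ∑ i ∈ Finset.range (n + 2), t ^ i • c i := by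
  induction n with
  | zero => exact ⟨fun i => if i = 0 then a else b, by simp, by simp, by
      simp [Finset.sum_range_succ]⟩
  | succ n ih =>
    obtain ⟨c, h0, h1, h⟩ := ih
    refine ⟨fun i => (if i < n + 2 then a * c i else 0) + if i = 0 then 0 else b * c (i - 1),
      ?_, ?_, ?_⟩
    · simp [h0, pow_succ']
    · rw [Finset.Nat.antidiagonal_succ, Finset.sum_cons, Finset.sum_map]
      simp [h0, h1, mul_assoc, pow_succ', add_comm, Finset.mul_sum]
    · intro t
      rw [pow_succ', h]
      simp only [smul_add, Finset.sum_add_distrib]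
      rw [Finset.sum_range_succ' (fun i => t ^ i • if i = 0 then 0 else b * c (i - 1)),
        Finset.sum_range_succ (fun i => t ^ i • if i < n + 2 then a * c i else 0), add_mul,
        Finset.mul_sum, Finset.mul_sum]
      simp only [lt_irrefl, if_false, smul_zero, add_zero, if_true, Nat.add_one_ne_zero,
        Nat.add_sub_cancel]
      congr 1
      · refine Finset.sum_congr rfl fun i hi => ?_
        rw [if_pos (Finset.mem_range.1 hi), mul_smul_comm]
      · refine Finset.sum_congr rfl fun i _ => ?_
        rw [smul_mul_smul_comm, ← pow_succ']

variable {V : Type*} [AddCommGroup V] [Module K V]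

/-- The coefficient of $t$ in $(v+tw)^{n+1}$ is $(n+1)v^n w$, and $n+1$ is invertible. -/
theorem pow_mul_ι_mem [CharZero K] (W : Submodule K (SymmetricAlgebra K V)) (n : ℕ)
    (h : ∀ v, SymmetricAlgebra.ι K V v ^ (n + 1) ∈ W) (v w : V) :
    SymmetricAlgebra.ι K V v ^ n * SymmetricAlgebra.ι K V w ∈ W := by
  obtain ⟨c, _, h1, hc⟩ := exists_add_smul_pow (K := K) (SymmetricAlgebra.ι K V v)
    (SymmetricAlgebra.ι K V w) n
  have := coeff_mem_of_forall_sum_mem W (n + 2) c (fun t => by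
    rw [← hc t, ← map_smul, ← map_add]; exact h _) 1 (by omega)
  have e : ∀ p ∈ antidiagonal n, (SymmetricAlgebra.ι K V v) ^ p.1 * SymmetricAlgebra.ι K V w *
      SymmetricAlgebra.ι K V v ^ p.2 = SymmetricAlgebra.ι K V v ^ n * SymmetricAlgebra.ι K V w := by
    intro p hp
    rw [Finset.HasAntidiagonal.mem_antidiagonal] at hp
    rw [mul_right_comm, ← pow_add, hp]
  rw [h1, Finset.sum_congr rfl e, Finset.sum_const, Finset.Nat.card_antidiagonal,
    ← Nat.cast_smul_eq_nsmul K] at this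
  exact (Submodule.smul_mem_iff W (Nat.cast_ne_zero.2 n.succ_ne_zero)).1 this

/-- The span contains $1$ and, by polarization, is stable under multiplication by vectors, which
generate the algebra. -/
theorem span_pow_ι [CharZero K] :
    Submodule.span K (Set.range fun p : V × ℕ => SymmetricAlgebra.ι K V p.1 ^ p.2) = ⊤ := by
  set W := Submodule.span K (Set.range fun p : V × ℕ => SymmetricAlgebra.ι K V p.1 ^ p.2) with hW
  have hpow : ∀ v n, SymmetricAlgebra.ι K V v ^ n ∈ W := fun v n =>
    Submodule.subset_span ⟨(v, n), rfl⟩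
  have hmul : ∀ x ∈ W, ∀ v, x * SymmetricAlgebra.ι K V v ∈ W := by
    intro x hx v
    induction hx using Submodule.span_induction with
    | mem _ h =>
      obtain ⟨⟨w, n⟩, rfl⟩ := h
      exact pow_mul_ι_mem W n (fun u => hpow u _) w v
    | zero => simp
    | add a b _ _ ha hb => rw [add_mul]; exact W.add_mem ha hb
    | smul r a _ ha => rw [smul_mul_assoc]; exact W.smul_mem r ha
  have hall : ∀ y : SymmetricAlgebra K V, ∀ x ∈ W, x * y ∈ W := by
    intro y
    induction y using SymmetricAlgebra.induction with
    | algebraMap r =>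
      intro x hx
      rw [mul_comm, ← Algebra.smul_def]
      exact W.smul_mem r hx
    | ι v => exact fun x hx => hmul x hx v
    | mul a b ha hb => intro x hx; rw [← mul_assoc]; exact hb _ (ha _ hx)
    | add a b ha hb => intro x hx; rw [mul_add]; exact W.add_mem (ha _ hx) (hb _ hx)
  refine eq_top_iff.2 fun y _ => ?_
  simpa using hall y 1 (by simpa using hpow 0 0)

theorem linearMap_ext_pow [CharZero K] {M : Type*} [AddCommGroup M] [Module K M]
    {f h : SymmetricAlgebra K V →ₗ[K] M}
    (H : ∀ v n, f (SymmetricAlgebra.ι K V v ^ n) = h (SymmetricAlgebra.ι K V v ^ n)) : f = h :=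
  LinearMap.ext_on span_pow_ι (by rintro _ ⟨p, rfl⟩; exact H _ _)

theorem homPart_pow_ι (n k : ℕ) (v : V) :
    homPart K n (SymmetricAlgebra.ι K V v ^ k) = if k = n then SymmetricAlgebra.ι K V v ^ k else 0 := by
  simpa using homPart_prod_ι K n (List.replicate k v)

theorem grade_pow_ι (k : ℕ) (v : V) :
    grade K (SymmetricAlgebra.ι K V v ^ k) = Polynomial.monomial k (SymmetricAlgebra.ι K V v ^ k) := by
  simpa using grade_prod_ι K (List.replicate k v)

variable {A : Type*} [Ring A] [Algebra K A] (f : V →ₗ[K] A)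

theorem symmetrization_pow [CharZero K] (v : V) (n : ℕ) :
    symmetrization f (SymmetricAlgebra.ι K V v ^ n) = f v ^ n := by
  have := symmetrization_prod f n (fun _ => v)
  simp only [Finset.prod_const, Finset.card_univ, Fintype.card_fin, List.ofFn_const,
    List.prod_replicate, Finset.sum_const, Fintype.card_perm] at this
  rw [this, ← Nat.cast_smul_eq_nsmul K, smul_smul,
    inv_mul_cancel₀ (Nat.cast_ne_zero.2 n.factorial_ne_zero), one_smul]

/-- Compare the coefficients of $t$ in the symmetrization of $(v+tw)^{n+1}$, which is $(f(v)+t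
f(w))^{n+1}$. -/
theorem symmetrization_pow_mul [CharZero K] (v w : V) (n : ℕ) :
    symmetrization f (SymmetricAlgebra.ι K V v ^ n * SymmetricAlgebra.ι K V w)
      = ((n : K) + 1)⁻¹ • ∑ p ∈ antidiagonal n, f v ^ p.1 * f w * f v ^ p.2 := by
  obtain ⟨c, _, h1, hc⟩ := exists_add_smul_pow (K := K) (SymmetricAlgebra.ι K V v)
    (SymmetricAlgebra.ι K V w) n
  obtain ⟨c', _, h1', hc'⟩ := exists_add_smul_pow (K := K) (f v) (f w) n
  have := coeff_eq_of_forall_sum_eq (n + 2) (fun i => symmetrization f (c i)) c' (fun t => by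
    rw [← hc' t, ← map_smul, ← map_add, ← symmetrization_pow, map_add, map_smul, hc t]
    simp) 1 (by omega)
  have e : ∀ p ∈ antidiagonal n, (SymmetricAlgebra.ι K V v) ^ p.1 * SymmetricAlgebra.ι K V w *
      SymmetricAlgebra.ι K V v ^ p.2 = SymmetricAlgebra.ι K V v ^ n * SymmetricAlgebra.ι K V w := by
    intro p hp
    rw [Finset.HasAntidiagonal.mem_antidiagonal] at hp
    rw [mul_right_comm, ← pow_add, hp]
  rw [← h1', ← this, h1, Finset.sum_congr rfl e, Finset.sum_const, Finset.Nat.card_antidiagonal,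
    ← Nat.cast_smul_eq_nsmul K, map_smul, smul_smul, Nat.cast_add_one,
    inv_mul_cancel₀ (Nat.cast_add_one_ne_zero n), one_smul]

end Polarization

/-! ### The addition law of $t/(1-e^{-t})$ -/

section BernoulliIdentity

/-- The coefficients `B_n^* / n!` of `t / (1 - e^{-t})`. -/
def bern (R : Type*) [CommRing R] [Algebra ℚ R] (n : ℕ) : R :=
  algebraMap ℚ R (bernoulli' n / n.factorial)

theorem mul_sum_antidiagonal_pow {A : Type*} [Ring A] {x y : A} (h : Commute x y) (n : ℕ) :
    (x - y) * ∑ p ∈ antidiagonal n, x ^ p.1 * y ^ p.2 = x ^ (n + 1) - y ^ (n + 1) := by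
  rw [Finset.Nat.sum_antidiagonal_eq_sum_range_succ (fun i j => x ^ i * y ^ j), ← h.mul_geom_sum₂]
  rfl

variable {R : Type*} [CommRing R] [Algebra ℚ R]

open PowerSeries in
-- The convention of `bernoulli'` is $B(t)(e^t-1)=te^t$, that is $B(t)=t/(1-e^{-t})$; here $t$ is
-- replaced by $at$.
theorem rescale_bernoulli'_mul (a : R) :
    rescale a (bernoulli'PowerSeries R) * (rescale a (exp R) - 1) = C a * X * rescale a (exp R) := by
  have := congrArg (rescale a) (bernoulli'PowerSeries_mul_exp_sub_one R)
  simpa [map_mul, rescale_X, mul_assoc] using this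

theorem rescale_exp_sub_one_ne_zero {a : R} (ha : a ≠ 0) :
    PowerSeries.rescale a (PowerSeries.exp R) - 1 ≠ 0 := by
  intro h
  have := congrArg (PowerSeries.coeff 1) h
  simp [PowerSeries.coeff_exp, PowerSeries.coeff_one] at this
  exact ha this

open PowerSeries in
-- With $\beta(x)=1/(1-e^{-xt})$ this is $\beta(x+y)(\beta(x)+\beta(y)-1)=\beta(x)\beta(y)$, the
-- addition theorem of $\coth$ in disguise. The denominators are cleared by multiplying with three
-- nonzero factors $e^{at}-1$.
theorem rescale_bernoulli'_add [IsDomain R] {x y : R} (hx : x ≠ 0) (hy : y ≠ 0) (hs : x + y ≠ 0) :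
    rescale (x + y) (bernoulli'PowerSeries R) * (C y * rescale x (bernoulli'PowerSeries R)
      + C x * rescale y (bernoulli'PowerSeries R) - C (x * y) * X)
      = C (x + y) * rescale x (bernoulli'PowerSeries R) * rescale y (bernoulli'PowerSeries R) := by
  have h1 := rescale_bernoulli'_mul x
  have h2 := rescale_bernoulli'_mul y
  have h3 := rescale_bernoulli'_mul (x + y)
  have h4 : rescale x (exp R) * rescale y (exp R) = rescale (x + y) (exp R) :=
    exp_mul_exp_eq_exp_add x y
  have n1 := rescale_exp_sub_one_ne_zero hx
  have n2 := rescale_exp_sub_one_ne_zero hy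
  have n3 := rescale_exp_sub_one_ne_zero hs
  refine mul_right_cancel₀ (mul_ne_zero (mul_ne_zero n1 n2) n3) ?_
  rw [← h4] at h3 n3 ⊢
  simp only [map_mul, map_add] at h3 ⊢
  generalize rescale x (exp R) = Ex at *
  generalize rescale y (exp R) = Ey at *
  generalize rescale x (bernoulli'PowerSeries R) = Bx at *
  generalize rescale y (bernoulli'PowerSeries R) = By at *
  generalize rescale (x + y) (bernoulli'PowerSeries R) = Bs at *
  generalize (C x : PowerSeries R) = cx at *
  generalize (C y : PowerSeries R) = cy at *
  have e1 : Bs * (cy * Bx + cx * By - cx * cy * X) * ((Ex - 1) * (Ey - 1) * (Ex * Ey - 1))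
      = (Bs * (Ex * Ey - 1)) * (cy * (Bx * (Ex - 1)) * (Ey - 1) + cx * (By * (Ey - 1)) * (Ex - 1)
        - cx * cy * X * (Ex - 1) * (Ey - 1)) := by ring
  have e2 : (cx + cy) * Bx * By * ((Ex - 1) * (Ey - 1) * (Ex * Ey - 1))
      = (cx + cy) * (Bx * (Ex - 1)) * (By * (Ey - 1)) * (Ex * Ey - 1) := by ring
  rw [e1, e2, h1, h2, h3]
  ring

/-- The coefficient of $t^{n+1}$ in the addition law, divided by $xy$. This arrangement matches the
commutator of two operators `leftAct`, with $x$ and $y$ standing for a derivation acting on either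
argument of a bracket. -/
theorem bern_identity [IsDomain R] {x y : R} (hx : x ≠ 0) (hy : y ≠ 0) (hs : x + y ≠ 0) (n : ℕ) :
    ∑ p ∈ antidiagonal n, bern R p.1 * bern R (p.2 + 1) *
      ∑ q ∈ antidiagonal p.2, (x + y) ^ q.1 * (x ^ p.1 * y ^ q.2 + x ^ q.2 * y ^ p.1)
      = bern R n * (x + y) ^ n := by
  have key := congrArg (PowerSeries.coeff (n + 1)) (rescale_bernoulli'_add hx hy hs)
  have cf : ∀ (a : R) (k : ℕ), PowerSeries.coeff k (PowerSeries.rescale a (bernoulli'PowerSeries R))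
      = a ^ k * bern R k := fun a k => by
    rw [PowerSeries.coeff_rescale, bernoulli'PowerSeries, PowerSeries.coeff_mk]; rfl
  have cm : ∀ a b : R, PowerSeries.coeff (n + 1) (PowerSeries.rescale a (bernoulli'PowerSeries R) *
      PowerSeries.rescale b (bernoulli'PowerSeries R))
      = ∑ p ∈ antidiagonal (n + 1), bern R p.1 * bern R p.2 * (a ^ p.1 * b ^ p.2) := fun a b => by
    rw [PowerSeries.coeff_mul]
    refine Finset.sum_congr rfl fun p _ => ?_
    rw [cf, cf]; ring
  have e : PowerSeries.rescale (x + y) (bernoulli'PowerSeries R) *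
      (PowerSeries.C y * PowerSeries.rescale x (bernoulli'PowerSeries R)
      + PowerSeries.C x * PowerSeries.rescale y (bernoulli'PowerSeries R)
        - PowerSeries.C (x * y) * PowerSeries.X)
      = PowerSeries.C y * (PowerSeries.rescale x (bernoulli'PowerSeries R) *
          PowerSeries.rescale (x + y) (bernoulli'PowerSeries R)) +
        PowerSeries.C x * (PowerSeries.rescale y (bernoulli'PowerSeries R) *
          PowerSeries.rescale (x + y) (bernoulli'PowerSeries R)) -
        PowerSeries.C (x * y) * (PowerSeries.rescale (x + y) (bernoulli'PowerSeries R) *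
          PowerSeries.X) := by ring
  rw [e, mul_assoc (PowerSeries.C (x + y))] at key
  simp only [map_add, map_sub, add_mul, PowerSeries.coeff_C_mul, PowerSeries.coeff_succ_mul_X, cf,
    cm] at key
  have sw : ∑ p ∈ antidiagonal (n + 1), bern R p.1 * bern R p.2 * (x ^ p.1 * y ^ p.2)
      = ∑ p ∈ antidiagonal (n + 1), bern R p.1 * bern R p.2 * (y ^ p.1 * x ^ p.2) := by
    rw [← Finset.Nat.sum_antidiagonal_swap]
    refine Finset.sum_congr rfl fun p _ => ?_
    simp only [Prod.fst_swap, Prod.snd_swap]; ring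
  -- The term $(x+y)B(xt)B(yt)$ is split into its $y$ and $x$ parts, so that only differences
  -- $(x+y)^j-y^j$ and $(x+y)^j-x^j$ remain. These vanish for $j=0$ and otherwise factor as $x$ or
  -- $y$ times a geometric sum.
  have key2 : y * ∑ p ∈ antidiagonal (n + 1), bern R p.1 * bern R p.2 *
        (x ^ p.1 * ((x + y) ^ p.2 - y ^ p.2))
      + x * ∑ p ∈ antidiagonal (n + 1), bern R p.1 * bern R p.2 *
        (y ^ p.1 * ((x + y) ^ p.2 - x ^ p.2)) = x * y * ((x + y) ^ n * bern R n) := by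
    simp only [mul_sub, Finset.sum_sub_distrib]
    rw [← sw]
    linear_combination key
  rw [Finset.Nat.sum_antidiagonal_succ', Finset.Nat.sum_antidiagonal_succ'] at key2
  simp only [pow_zero, sub_self, mul_zero, zero_add] at key2
  refine mul_left_cancel₀ (mul_ne_zero hx hy) ?_
  rw [mul_comm (bern R n), ← key2, Finset.mul_sum, Finset.mul_sum, Finset.mul_sum,
    ← Finset.sum_add_distrib]
  refine Finset.sum_congr rfl fun p _ => ?_
  have g1 := mul_sum_antidiagonal_pow (Commute.all (x + y) y) p.2
  have g2 := mul_sum_antidiagonal_pow (Commute.all (x + y) x) p.2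
  rw [← g1, ← g2]
  simp only [mul_add, Finset.sum_add_distrib, mul_left_comm _ (x ^ p.1), ← Finset.mul_sum]
  simp only [mul_comm _ (y ^ p.1), mul_left_comm _ (y ^ p.1), ← Finset.mul_sum]
  ring

end BernoulliIdentity

/-! ### From polynomial identities to identities for a derivation -/

section Transfer

variable {K : Type*} [Field K] {V : Type*} [AddCommGroup V] [Module K V]

/-- The linear map `X₀ ^ a X₁ ^ b ↦ μ (d ^ a u) (d ^ b w)`. -/
def bilinEval (μ : V →ₗ[K] V →ₗ[K] V) (d : Module.End K V) (u w : V) :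
    MvPolynomial (Fin 2) K →ₗ[K] V :=
  (MvPolynomial.basisMonomials (Fin 2) K).constr K fun m => μ ((d ^ m 0) u) ((d ^ m 1) w)

theorem bilinEval_X_pow (μ : V →ₗ[K] V →ₗ[K] V) (d : Module.End K V) (u w : V) (a b : ℕ) :
    bilinEval μ d u w (MvPolynomial.X 0 ^ a * MvPolynomial.X 1 ^ b) = μ ((d ^ a) u) ((d ^ b) w) := by
  have : (MvPolynomial.X 0 ^ a * MvPolynomial.X 1 ^ b : MvPolynomial (Fin 2) K)
      = MvPolynomial.basisMonomials (Fin 2) K (Finsupp.single 0 a + Finsupp.single 1 b) := by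
    simp [MvPolynomial.X_pow_eq_monomial, MvPolynomial.monomial_mul]
  rw [this, bilinEval, Module.Basis.constr_basis]
  simp

/-- This is the Leibniz rule: $X_0$ and $X_1$ apply $d$ to one argument each, so their sum applies
$d$ to the value. -/
theorem bilinEval_add_mul {μ : V →ₗ[K] V →ₗ[K] V} {d : Module.End K V}
    (hd : ∀ u w, d (μ u w) = μ (d u) w + μ u (d w)) (u w : V) (P : MvPolynomial (Fin 2) K) :
    bilinEval μ d u w ((MvPolynomial.X 0 + MvPolynomial.X 1) * P) = d (bilinEval μ d u w P) := by
  have : bilinEval μ d u w ∘ₗ LinearMap.mulLeft K (MvPolynomial.X 0 + MvPolynomial.X 1)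
      = d ∘ₗ bilinEval μ d u w := by
    refine (MvPolynomial.basisMonomials (Fin 2) K).ext fun m => ?_
    have hm : MvPolynomial.basisMonomials (Fin 2) K m
        = MvPolynomial.X 0 ^ m 0 * MvPolynomial.X 1 ^ m 1 := by
      simp [MvPolynomial.X_pow_eq_monomial, MvPolynomial.monomial_mul]
      ext i
      fin_cases i <;> simp
    have e : (MvPolynomial.X 0 + MvPolynomial.X 1) *
        (MvPolynomial.X 0 ^ m 0 * MvPolynomial.X 1 ^ m 1 : MvPolynomial (Fin 2) K)
        = MvPolynomial.X 0 ^ (m 0 + 1) * MvPolynomial.X 1 ^ m 1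
          + MvPolynomial.X 0 ^ m 0 * MvPolynomial.X 1 ^ (m 1 + 1) := by ring
    rw [hm, LinearMap.comp_apply, LinearMap.comp_apply, LinearMap.mulLeft_apply, e, map_add]
    simp only [bilinEval_X_pow, hd]
    simp only [pow_succ', Module.End.mul_apply]
  exact LinearMap.congr_fun this P

/-- The image of `bern_identity` in $K[X_0,X_1]$ under `bilinEval`. It is needed for the Lie bracket
and $d=-\mathrm{ad}_\eta$. -/
theorem bern_bilin_identity [CharZero K] {μ : V →ₗ[K] V →ₗ[K] V} {d : Module.End K V}
    (hd : ∀ u w, d (μ u w) = μ (d u) w + μ u (d w)) (u w : V) (n : ℕ) :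
    ∑ p ∈ antidiagonal n, (bern K p.1 * bern K (p.2 + 1)) •
      ∑ q ∈ antidiagonal p.2, (d ^ q.1) (μ ((d ^ p.1) u) ((d ^ q.2) w)
        + μ ((d ^ q.2) u) ((d ^ p.1) w))
      = bern K n • (d ^ n) (μ u w) := by
  have hs : (MvPolynomial.X 0 + MvPolynomial.X 1 : MvPolynomial (Fin 2) K) ≠ 0 := by
    intro h
    have := congrArg (MvPolynomial.eval ![1, 0]) h
    simp at this
  have h := congrArg (bilinEval μ d u w) (bern_identity (R := MvPolynomial (Fin 2) K)
    (MvPolynomial.X_ne_zero 0) (MvPolynomial.X_ne_zero 1) hs n)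
  have hb : ∀ k, bern (MvPolynomial (Fin 2) K) k = MvPolynomial.C (bern K k) := fun k =>
    IsScalarTower.algebraMap_apply ℚ K (MvPolynomial (Fin 2) K) _
  have hp : ∀ k P, bilinEval μ d u w ((MvPolynomial.X 0 + MvPolynomial.X 1) ^ k * P)
      = (d ^ k) (bilinEval μ d u w P) := by
    intro k
    induction k with
    | zero => simp
    | succ k ih => intro P; rw [pow_succ', mul_assoc, bilinEval_add_mul hd, ih, pow_succ']; rfl
  have hone : bilinEval μ d u w ((MvPolynomial.X 0 + MvPolynomial.X 1) ^ n)
      = (d ^ n) (μ u w) := by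
    have := hp n (MvPolynomial.X 0 ^ 0 * MvPolynomial.X 1 ^ 0)
    rw [bilinEval_X_pow] at this
    simpa using this
  simp only [hb, ← map_mul, ← MvPolynomial.smul_eq_C_mul, map_sum, map_smul, hp, map_add,
    bilinEval_X_pow, hone] at h ⊢
  exact h

end Transfer
open scoped TensorProduct

/-! ### Divided powers and the coproduct of the symmetric algebra -/

section DividedPowers

variable (K : Type*) [Field K] {V : Type*} [AddCommGroup V] [Module K V]

/-- The divided power `v ^ n / n!` in the symmetric algebra. -/
def divPow (n : ℕ) (v : V) : SymmetricAlgebra K V :=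
  (n.factorial : K)⁻¹ • SymmetricAlgebra.ι K V v ^ n

theorem divPow_zero (v : V) : divPow K 0 v = 1 := by simp [divPow]

variable {K} in
theorem pow_ι_eq_smul_divPow [CharZero K] (n : ℕ) (v : V) :
    SymmetricAlgebra.ι K V v ^ n = (n.factorial : K) • divPow K n v := by
  rw [divPow, smul_smul, mul_inv_cancel₀ (Nat.cast_ne_zero.2 n.factorial_ne_zero), one_smul]

variable {K} in
theorem linearMap_ext_divPow [CharZero K] {M : Type*} [AddCommGroup M] [Module K M]
    {f h : SymmetricAlgebra K V →ₗ[K] M} (H : ∀ v n, f (divPow K n v) = h (divPow K n v)) :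
    f = h :=
  linearMap_ext_pow fun v n => by rw [pow_ι_eq_smul_divPow, map_smul, map_smul, H]

theorem grade_divPow (n : ℕ) (v : V) :
    grade K (divPow K n v) = Polynomial.monomial n (divPow K n v) := by
  rw [divPow, map_smul, grade_pow_ι, Polynomial.smul_monomial]

theorem homPart_divPow (n k : ℕ) (v : V) :
    homPart K n (divPow K k v) = if k = n then divPow K k v else 0 := by
  rw [divPow, map_smul, homPart_pow_ι]
  split_ifs <;> simp

theorem inv_factorial_smul_add_pow [CharZero K] {A : Type*} [Ring A] [Algebra K A] {a b : A}
    (h : Commute a b) (n : ℕ) :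
    (n.factorial : K)⁻¹ • (a + b) ^ n = ∑ p ∈ antidiagonal n,
      ((p.1.factorial : K)⁻¹ • a ^ p.1) * ((p.2.factorial : K)⁻¹ • b ^ p.2) := by
  rw [h.add_pow', Finset.smul_sum]
  refine Finset.sum_congr rfl fun p hp => ?_
  rw [Finset.HasAntidiagonal.mem_antidiagonal] at hp
  subst hp
  rw [← Nat.cast_smul_eq_nsmul K, smul_smul, smul_mul_smul_comm]
  congr 1
  rw [Nat.cast_choose K (Nat.le_add_right _ _), Nat.add_sub_cancel_left]
  have := Nat.cast_ne_zero (R := K).2 (p.1 + p.2).factorial_ne_zero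
  field_simp

variable (V) in
/-- The coproduct of the symmetric algebra. -/
def comulSym : SymmetricAlgebra K V →ₐ[K] SymmetricAlgebra K V ⊗[K] SymmetricAlgebra K V :=
  SymmetricAlgebra.lift
    ((Algebra.TensorProduct.includeLeft (R := K) (S := K)).toLinearMap ∘ₗ SymmetricAlgebra.ι K V
      + (Algebra.TensorProduct.includeRight (R := K)).toLinearMap ∘ₗ SymmetricAlgebra.ι K V)

theorem comulSym_ι (v : V) : comulSym K V (SymmetricAlgebra.ι K V v)
    = SymmetricAlgebra.ι K V v ⊗ₜ 1 + 1 ⊗ₜ SymmetricAlgebra.ι K V v := by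
  simp [comulSym]

theorem comulSym_divPow [CharZero K] (n : ℕ) (v : V) :
    comulSym K V (divPow K n v) = ∑ p ∈ antidiagonal n, divPow K p.1 v ⊗ₜ divPow K p.2 v := by
  rw [divPow, map_smul, map_pow, comulSym_ι, inv_factorial_smul_add_pow K (Commute.all _ _)]
  refine Finset.sum_congr rfl fun p _ => ?_
  simp [divPow, Algebra.TensorProduct.tmul_pow, TensorProduct.smul_tmul']

theorem comulSym_divPow_mul [CharZero K] (n : ℕ) (v w : V) :
    comulSym K V (divPow K n v * SymmetricAlgebra.ι K V w) = ∑ p ∈ antidiagonal n,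
      ((divPow K p.1 v * SymmetricAlgebra.ι K V w) ⊗ₜ divPow K p.2 v
        + divPow K p.1 v ⊗ₜ (divPow K p.2 v * SymmetricAlgebra.ι K V w)) := by
  rw [map_mul, comulSym_divPow, comulSym_ι, Finset.sum_mul]
  refine Finset.sum_congr rfl fun p _ => ?_
  simp [mul_add]

end DividedPowers

/-! ### A representation on $\mathrm{Sym}(\mathfrak g)$ and injectivity of $\mathfrak q$ -/

section Representation

variable (K : Type*) [Field K] (g : Type*) [LieRing g] [LieAlgebra K g]

/-- The linear map `η ^ n ↦ B_n^* (-ad η) ^ n`. -/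
def bernAd : SymmetricAlgebra K g →ₗ[K] Module.End K g :=
  (Polynomial.lsum fun n => ((bernoulli' n : ℚ) : K) •
      symmetrization (-(LieAlgebra.ad K g : g →ₗ[K] Module.End K g))) ∘ₗ
    (grade K).toLinearMap

variable {g}

theorem bernAd_of_grade {x : SymmetricAlgebra K g} {n : ℕ}
    (h : grade K x = Polynomial.monomial n x) :
    bernAd K g x = ((bernoulli' n : ℚ) : K) •
      symmetrization (-(LieAlgebra.ad K g : g →ₗ[K] Module.End K g)) x := by
  rw [bernAd, LinearMap.comp_apply, AlgHom.toLinearMap_apply, h, Polynomial.lsum_apply,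
    Polynomial.sum_monomial_index _ _ (by simp)]
  simp

variable [CharZero K]

theorem bern_eq (n : ℕ) : bern K n = ((bernoulli' n : ℚ) : K) * (n.factorial : K)⁻¹ := by
  simp [bern, div_eq_mul_inv]

theorem bernAd_divPow (n : ℕ) (v : g) :
    bernAd K g (divPow K n v) = bern K n • (-LieAlgebra.ad K g v) ^ n := by
  rw [bernAd_of_grade K (grade_divPow K n v), divPow, map_smul, symmetrization_pow, smul_smul,
    ← bern_eq]
  simp

theorem bernAd_divPow_mul (n : ℕ) (v w : g) :
    bernAd K g (divPow K n v * SymmetricAlgebra.ι K g w)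
      = bern K (n + 1) • ∑ p ∈ antidiagonal n,
        (-LieAlgebra.ad K g v) ^ p.1 * (-LieAlgebra.ad K g w) * (-LieAlgebra.ad K g v) ^ p.2 := by
  rw [bernAd_of_grade K (n := n + 1) (by
    rw [map_mul, grade_divPow, grade_ι, Polynomial.monomial_mul_monomial]), divPow,
    smul_mul_assoc, map_smul, symmetrization_pow_mul, smul_smul, smul_smul, bern_eq]
  congr 1
  rw [Nat.factorial_succ, Nat.cast_mul, mul_inv_rev, Nat.cast_add_one, mul_assoc]

/-- Left multiplication by `ξ` with respect to the star product, as an operator on `Sym(g)`: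
`η ^ k ↦ ∑ⱼ (k choose j) B_j^* η ^ {k - j} (-ad η) ^ j ξ`. -/
def leftAct : g →ₗ[K] Module.End K (SymmetricAlgebra K g) :=
  LinearMap.mk₂ K (fun ξ x => LinearMap.mul' K (SymmetricAlgebra K g)
      (((SymmetricAlgebra.ι K g ∘ₗ (bernAd K g).flip ξ).lTensor _) (comulSym K g x)))
    (fun ξ ξ' x => by simp [LinearMap.comp_add, LinearMap.lTensor_add])
    (fun c ξ x => by simp [LinearMap.comp_smul, LinearMap.lTensor_smul])
    (fun ξ x x' => by simp)
    (fun c ξ x => by simp)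

theorem leftAct_divPow (ξ η : g) (n : ℕ) :
    leftAct K ξ (divPow K n η) = ∑ p ∈ antidiagonal n, bern K p.2 •
      (divPow K p.1 η * SymmetricAlgebra.ι K g (((-LieAlgebra.ad K g η) ^ p.2) ξ)) := by
  simp [leftAct, comulSym_divPow, bernAd_divPow]

/-- One application of `leftAct` to a power of $\eta$ leaves the line of powers of $\eta$ by one
factor $w$, so composing two operators requires this case. The coproduct sends $w$ either to the
factor left untouched or into the argument of `bernAd`, giving the two summands. -/
theorem leftAct_divPow_mul (ξ η w : g) (n : ℕ) :
    leftAct K ξ (divPow K n η * SymmetricAlgebra.ι K g w) = ∑ p ∈ antidiagonal n,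
      (bern K p.2 • (divPow K p.1 η * SymmetricAlgebra.ι K g w *
          SymmetricAlgebra.ι K g (((-LieAlgebra.ad K g η) ^ p.2) ξ))
        + bern K (p.2 + 1) • (divPow K p.1 η * SymmetricAlgebra.ι K g (∑ q ∈ antidiagonal p.2,
          ((-LieAlgebra.ad K g η) ^ q.1) ⁅((-LieAlgebra.ad K g η) ^ q.2) ξ, w⁆))) := by
  simp [leftAct, comulSym_divPow_mul, bernAd_divPow, bernAd_divPow_mul]
  simp only [← lie_skew w, map_neg, Finset.sum_neg_distrib, mul_neg, smul_neg, neg_neg]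

theorem sum_antidiagonal_assoc {M : Type*} [AddCommMonoid M] (F : ℕ → ℕ → ℕ → M) (k : ℕ) :
    ∑ p ∈ antidiagonal k, ∑ q ∈ antidiagonal p.1, F q.1 q.2 p.2
      = ∑ p ∈ antidiagonal k, ∑ q ∈ antidiagonal p.2, F p.1 q.2 q.1 := by
  rw [Finset.sum_sigma', Finset.sum_sigma']
  refine Finset.sum_nbij' (fun x => ⟨(x.2.1, x.1.2 + x.2.2), (x.1.2, x.2.2)⟩)
    (fun x => ⟨(x.1.1 + x.2.2, x.2.1), (x.1.1, x.2.2)⟩) ?_ ?_ ?_ ?_ ?_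
  · rintro ⟨⟨a, b⟩, ⟨c, d⟩⟩ h
    simp only [Finset.mem_sigma, Finset.HasAntidiagonal.mem_antidiagonal, and_true] at h ⊢
    omega
  · rintro ⟨⟨a, b⟩, ⟨c, d⟩⟩ h
    simp only [Finset.mem_sigma, Finset.HasAntidiagonal.mem_antidiagonal, and_true] at h ⊢
    omega
  · rintro ⟨⟨a, b⟩, ⟨c, d⟩⟩ h
    simp only [Finset.mem_sigma, Finset.HasAntidiagonal.mem_antidiagonal] at h ⊢
    obtain ⟨rfl, rfl⟩ := h
    rfl
  · rintro ⟨⟨a, b⟩, ⟨c, d⟩⟩ h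
    simp only [Finset.mem_sigma, Finset.HasAntidiagonal.mem_antidiagonal] at h ⊢
    obtain ⟨rfl, rfl⟩ := h
    rfl
  · rintro ⟨⟨a, b⟩, ⟨c, d⟩⟩ _
    rfl

theorem leftAct_leftAct_divPow (ζ ξ η : g) (k : ℕ) :
    leftAct K ζ (leftAct K ξ (divPow K k η)) = ∑ p ∈ antidiagonal k,
      (∑ q ∈ antidiagonal p.2, (bern K q.1 * bern K q.2) • (divPow K p.1 η *
          SymmetricAlgebra.ι K g (((-LieAlgebra.ad K g η) ^ q.1) ξ) *
          SymmetricAlgebra.ι K g (((-LieAlgebra.ad K g η) ^ q.2) ζ))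
        + divPow K p.1 η * SymmetricAlgebra.ι K g (∑ q ∈ antidiagonal p.2,
          (bern K q.1 * bern K (q.2 + 1)) • ∑ r ∈ antidiagonal q.2,
            ((-LieAlgebra.ad K g η) ^ r.1)
              ⁅((-LieAlgebra.ad K g η) ^ r.2) ζ, ((-LieAlgebra.ad K g η) ^ q.1) ξ⁆)) := by
  rw [leftAct_divPow, map_sum]
  simp only [map_smul, leftAct_divPow_mul, Finset.smul_sum]
  rw [sum_antidiagonal_assoc (fun a i j => bern K j •
      (bern K i • (divPow K a η * SymmetricAlgebra.ι K g (((-LieAlgebra.ad K g η) ^ j) ξ) *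
          SymmetricAlgebra.ι K g (((-LieAlgebra.ad K g η) ^ i) ζ))
        + bern K (i + 1) • (divPow K a η * SymmetricAlgebra.ι K g (∑ q ∈ antidiagonal i,
          ((-LieAlgebra.ad K g η) ^ q.1)
            ⁅((-LieAlgebra.ad K g η) ^ q.2) ζ, ((-LieAlgebra.ad K g η) ^ j) ξ⁆)))) k]
  refine Finset.sum_congr rfl fun p _ => ?_
  rw [map_sum, Finset.mul_sum, ← Finset.sum_add_distrib]
  refine Finset.sum_congr rfl fun q _ => ?_
  rw [← Finset.smul_sum, map_smul, mul_smul_comm, smul_add, smul_smul, smul_smul]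

/-- In the commutator the products of two iterated brackets cancel, being symmetric in $\zeta$ and
$\xi$. What remains is linear in brackets of $\zeta$ with $\xi$ and is evaluated by
`bern_bilin_identity`. -/
theorem leftAct_lie (ζ ξ : g) :
    leftAct K ⁅ζ, ξ⁆ = leftAct K ζ * leftAct K ξ - leftAct K ξ * leftAct K ζ := by
  refine linearMap_ext_divPow fun η k => ?_
  rw [LinearMap.sub_apply, Module.End.mul_apply, Module.End.mul_apply, leftAct_leftAct_divPow,
    leftAct_leftAct_divPow, leftAct_divPow, ← Finset.sum_sub_distrib]
  refine Finset.sum_congr rfl fun p _ => ?_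
  have hsymm : ∑ q ∈ antidiagonal p.2, (bern K q.1 * bern K q.2) • (divPow K p.1 η *
          SymmetricAlgebra.ι K g (((-LieAlgebra.ad K g η) ^ q.1) ξ) *
          SymmetricAlgebra.ι K g (((-LieAlgebra.ad K g η) ^ q.2) ζ))
      = ∑ q ∈ antidiagonal p.2, (bern K q.1 * bern K q.2) • (divPow K p.1 η *
          SymmetricAlgebra.ι K g (((-LieAlgebra.ad K g η) ^ q.1) ζ) *
          SymmetricAlgebra.ι K g (((-LieAlgebra.ad K g η) ^ q.2) ξ)) := by
    rw [← Finset.Nat.sum_antidiagonal_swap]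
    refine Finset.sum_congr rfl fun q _ => ?_
    simp only [Prod.fst_swap, Prod.snd_swap]
    rw [mul_right_comm, mul_comm (bern K q.2)]
  rw [hsymm, add_sub_add_left_eq_sub, ← mul_sub, ← map_sub, ← mul_smul_comm, ← map_smul,
    ← Finset.sum_sub_distrib]
  congr 2
  have key := bern_bilin_identity (K := K) (μ := (LieModule.toEnd K g g : g →ₗ[K] Module.End K g))
    (d := -LieAlgebra.ad K g η) (fun u w => by
      simp only [LinearMap.neg_apply, LieAlgebra.ad_apply, LieHom.coe_toLinearMap,
        LieModule.toEnd_apply_apply, neg_lie, lie_neg, leibniz_lie η u w, neg_add]) ζ ξ p.2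
  simp only [LieHom.coe_toLinearMap, LieModule.toEnd_apply_apply] at key
  rw [← key]
  refine Finset.sum_congr rfl fun q _ => ?_
  rw [← smul_sub, ← Finset.sum_sub_distrib]
  congr 1
  refine Finset.sum_congr rfl fun r _ => ?_
  rw [← map_sub, ← lie_skew (((-LieAlgebra.ad K g η) ^ q.1) ζ), neg_add_eq_sub]

/-- The representation of `g` on `Sym(g)` by left star multiplication. -/
def leftRep : g →ₗ⁅K⁆ Module.End K (SymmetricAlgebra K g) :=
  { leftAct K with
    map_lie' := fun {ζ ξ} => by
      simpa [LieRing.of_associative_ring_bracket] using leftAct_lie K ζ ξ }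

/-- Since $\mathrm{ad}_\eta\,\eta=0$, only the term $j=0$ survives, and $B_0^*=1$. -/
theorem leftAct_self_pow (η : g) (n : ℕ) :
    leftAct K η (SymmetricAlgebra.ι K g η ^ n) = SymmetricAlgebra.ι K g η ^ (n + 1) := by
  rw [pow_ι_eq_smul_divPow, map_smul, leftAct_divPow,
    Finset.sum_eq_single (n, 0)]
  · rw [← mul_smul_comm, pow_succ, pow_ι_eq_smul_divPow, smul_mul_assoc]
    simp [bern]
  · rintro ⟨a, b⟩ hp hne
    have hb : b ≠ 0 := by
      rintro rfl
      rw [Finset.HasAntidiagonal.mem_antidiagonal] at hp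
      exact hne (by simpa using hp)
    obtain ⟨b, rfl⟩ := Nat.exists_eq_succ_of_ne_zero hb
    simp [pow_succ]
  · simp

/-- The representation extends to $U(\mathfrak g)$, and acting on the vector $1$ sends
$\eta^n=\mathfrak q(\eta^n)$ back to $\eta^n$. Thus $\mathfrak q$ has a left inverse. -/
theorem quant_injective : Function.Injective (quant K g) := by
  set r : UniversalEnvelopingAlgebra K g →ₗ[K] SymmetricAlgebra K g :=
    (LinearMap.applyₗ (1 : SymmetricAlgebra K g)) ∘ₗ
      (UniversalEnvelopingAlgebra.lift K (leftRep K (g := g))).toLinearMap with hr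
  have hpow : ∀ (η : g) n, ((leftAct K η) ^ n) 1 = SymmetricAlgebra.ι K g η ^ n := by
    intro η n
    induction n with
    | zero => simp
    | succ n ih => rw [pow_succ', Module.End.mul_apply, ih, leftAct_self_pow]
  have h : r ∘ₗ quant K g = LinearMap.id := by
    refine linearMap_ext_pow fun η n => ?_
    rw [LinearMap.comp_apply, quant, symmetrization_pow, hr]
    simp only [LinearMap.comp_apply, AlgHom.toLinearMap_apply, map_pow, LieHom.coe_toLinearMap,
      UniversalEnvelopingAlgebra.lift_ι_apply, LinearMap.applyₗ_apply_apply, LinearMap.id_apply]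
    exact hpow η n
  exact Function.LeftInverse.injective (g := r) (LinearMap.congr_fun h)

end Representation

/-! ### Right multiplication of a symmetrized power by a generator -/

section RightMultiplication

open PowerSeries in
-- The coefficient of $t^{k+1}$ in $B((x-y)t)(e^{xt}-e^{yt})=(x-y)t\,e^{xt}$, divided by $x-y$.
theorem bern_identity_right {R : Type*} [CommRing R] [Algebra ℚ R] [IsDomain R] {x y : R}
    (hs : x - y ≠ 0) (k : ℕ) :
    ∑ p ∈ antidiagonal k, bern R p.2 * algebraMap ℚ R (1 / (p.1 + 1).factorial) *
      ∑ q ∈ antidiagonal p.1, (x - y) ^ p.2 * (x ^ q.1 * y ^ q.2)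
      = algebraMap ℚ R (1 / k.factorial) * x ^ k := by
  have h : rescale (x - y) (bernoulli'PowerSeries R) * (rescale x (exp R) - rescale y (exp R))
      = C (x - y) * (rescale x (exp R) * X) := by
    have h1 := rescale_bernoulli'_mul (x - y)
    have h2 : rescale (x - y) (exp R) * rescale y (exp R) = rescale (x - y + y) (exp R) :=
      exp_mul_exp_eq_exp_add _ _
    rw [sub_add_cancel] at h2
    rw [← h2]
    linear_combination (rescale y (exp R)) * h1
  have key := congrArg (coeff (k + 1)) h
  rw [coeff_C_mul, coeff_succ_mul_X, coeff_mul, Finset.Nat.sum_antidiagonal_succ'] at key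
  simp only [map_sub, coeff_rescale, coeff_exp, pow_zero, sub_self, mul_zero, zero_add,
    bernoulli'PowerSeries, coeff_mk] at key
  refine mul_left_cancel₀ hs ?_
  rw [mul_comm (algebraMap ℚ R _), ← key, Finset.mul_sum, ← Finset.Nat.sum_antidiagonal_swap]
  refine Finset.sum_congr rfl fun p _ => ?_
  simp only [Prod.fst_swap, Prod.snd_swap]
  rw [← Finset.mul_sum, bern]
  have g := mul_sum_antidiagonal_pow (Commute.all x y) p.2
  linear_combination ((x - y) ^ p.1 * algebraMap ℚ R (bernoulli' p.1 / p.1.factorial) *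
    algebraMap ℚ R (1 / (p.2 + 1).factorial)) * g

variable {K : Type*} [Field K] {A : Type*} [Ring A] [Algebra K A]

/-- The linear map `X₀ ^ a X₁ ^ b ↦ x ^ a y x ^ b`. -/
def sandwich (x y : A) : MvPolynomial (Fin 2) K →ₗ[K] A :=
  bilinEval ((LinearMap.mul K A).comp (LinearMap.mulRight K y)) (LinearMap.mulLeft K x) 1 1

theorem sandwich_X_pow (x y : A) (a b : ℕ) :
    sandwich (K := K) x y (MvPolynomial.X 0 ^ a * MvPolynomial.X 1 ^ b) = x ^ a * y * x ^ b := by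
  simp [sandwich, bilinEval_X_pow, LinearMap.pow_mulLeft]

/-- $X_0$ and $X_1$ act as left and right multiplication by $x$, so their difference is the
commutator, which can be absorbed into the middle factor. -/
theorem sandwich_sub_mul (x y : A) (P : MvPolynomial (Fin 2) K) :
    sandwich x y ((MvPolynomial.X 0 - MvPolynomial.X 1) * P) = sandwich x (x * y - y * x) P := by
  have : sandwich x y ∘ₗ LinearMap.mulLeft K (MvPolynomial.X 0 - MvPolynomial.X 1)
      = sandwich x (x * y - y * x) := by
    refine (MvPolynomial.basisMonomials (Fin 2) K).ext fun m => ?_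
    have hm : MvPolynomial.basisMonomials (Fin 2) K m
        = MvPolynomial.X 0 ^ m 0 * MvPolynomial.X 1 ^ m 1 := by
      simp [MvPolynomial.X_pow_eq_monomial, MvPolynomial.monomial_mul]
      ext i
      fin_cases i <;> simp
    have e : (MvPolynomial.X 0 - MvPolynomial.X 1) *
        (MvPolynomial.X 0 ^ m 0 * MvPolynomial.X 1 ^ m 1 : MvPolynomial (Fin 2) K)
        = MvPolynomial.X 0 ^ (m 0 + 1) * MvPolynomial.X 1 ^ m 1
          - MvPolynomial.X 0 ^ m 0 * MvPolynomial.X 1 ^ (m 1 + 1) := by ring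
    rw [hm, LinearMap.comp_apply, LinearMap.mulLeft_apply, e, map_sub]
    simp only [sandwich_X_pow]
    simp only [pow_succ x (m 0), pow_succ' x (m 1), mul_sub, sub_mul, mul_assoc]
  exact LinearMap.congr_fun this P

theorem sandwich_sub_pow_mul (x : A) (y : ℕ → A) (hy : ∀ j, y (j + 1) = x * y j - y j * x) (j : ℕ)
    (P : MvPolynomial (Fin 2) K) :
    sandwich x (y 0) ((MvPolynomial.X 0 - MvPolynomial.X 1) ^ j * P) = sandwich x (y j) P := by
  induction j generalizing P with
  | zero => simp
  | succ j ih => rw [pow_succ, mul_assoc, ih, sandwich_sub_mul, hy]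

/-- `bern_identity_right` evaluated at left and right multiplication by $x$, the powers of $X_0-X_1$
becoming iterated commutators. -/
theorem pow_mul_eq_sum_bern [CharZero K] (x : A) (y : ℕ → A)
    (hy : ∀ j, y (j + 1) = x * y j - y j * x) (k : ℕ) :
    (k.factorial : K)⁻¹ • (x ^ k * y 0) = ∑ p ∈ antidiagonal k,
      (bern K p.2 * ((p.1 + 1).factorial : K)⁻¹) •
        ∑ q ∈ antidiagonal p.1, x ^ q.1 * y p.2 * x ^ q.2 := by
  have hs : (MvPolynomial.X 0 - MvPolynomial.X 1 : MvPolynomial (Fin 2) K) ≠ 0 := by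
    intro h
    have := congrArg (MvPolynomial.eval ![1, 0]) h
    simp at this
  have h := congrArg (sandwich x (y 0)) (bern_identity_right (R := MvPolynomial (Fin 2) K) hs k)
  have hb : ∀ k, bern (MvPolynomial (Fin 2) K) k = MvPolynomial.C (bern K k) := fun k =>
    IsScalarTower.algebraMap_apply ℚ K (MvPolynomial (Fin 2) K) _
  have hb' : ∀ k : ℕ, algebraMap ℚ (MvPolynomial (Fin 2) K) (1 / k.factorial)
      = MvPolynomial.C ((k.factorial : K)⁻¹) := fun k => by
    rw [IsScalarTower.algebraMap_apply ℚ K (MvPolynomial (Fin 2) K)]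
    simp [MvPolynomial.algebraMap_eq]
  have hone := sandwich_X_pow (K := K) x (y 0) k 0
  simp only [pow_zero, mul_one] at hone
  simp only [hb, hb', ← map_mul, ← MvPolynomial.smul_eq_C_mul, map_sum, map_smul, hone,
    sandwich_sub_pow_mul x y hy, sandwich_X_pow] at h
  exact h.symm

theorem symmetrization_one [CharZero K] {V : Type*} [AddCommGroup V] [Module K V] (f : V →ₗ[K] A) :
    symmetrization f 1 = 1 := by
  simpa using symmetrization_pow f 0 0

/-- The inner sums of `pow_mul_eq_sum_bern` are symmetrizations by `symmetrization_pow_mul`. Stating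
it for a sequence `w` of iterated brackets lets one proof serve both $U(\mathfrak g)$ and
$U(\mathfrak g_z)$. -/
theorem symmetrization_mul [CharZero K] {V : Type*} [AddCommGroup V] [Module K V] (f : V →ₗ[K] A)
    (ξ : V) (w : ℕ → V) (hw : ∀ j, f (w (j + 1)) = f ξ * f (w j) - f (w j) * f ξ) (k : ℕ) :
    symmetrization f (divPow K k ξ) * f (w 0) = symmetrization f (∑ p ∈ antidiagonal k,
      bern K p.2 • (divPow K p.1 ξ * SymmetricAlgebra.ι K V (w p.2))) := by
  rw [divPow, map_smul, symmetrization_pow, smul_mul_assoc,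
    pow_mul_eq_sum_bern (K := K) (f ξ) (fun j => f (w j)) hw, map_sum]
  refine Finset.sum_congr rfl fun p _ => ?_
  rw [map_smul, divPow, smul_mul_assoc, map_smul, symmetrization_pow_mul, smul_smul, smul_smul,
    Nat.factorial_succ, Nat.cast_mul, Nat.cast_succ, mul_inv_rev, mul_assoc]

end RightMultiplication

/-! ### Products pulled back along a bijective symmetrization -/

section Pullback

variable {K : Type*} [Field K] {A : Type*} [Ring A] [Algebra K A] {V : Type*} [AddCommGroup V]
  [Module K V]

theorem linearInverse_apply {W : Type*} [AddCommGroup W] [Module K W] {f : V →ₗ[K] W}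
    (hf : Function.Bijective f) (w : W) : f (linearInverse K f w) = w := by
  rw [linearInverse, dif_pos hf]
  exact (LinearEquiv.ofBijective f hf).apply_symm_apply w

theorem map_pullbackMul {f : V →ₗ[K] A} (hf : Function.Bijective f) (x y : V) :
    f (pullbackMul K f x y) = f x * f y :=
  linearInverse_apply hf _

theorem pullbackMul_assoc {f : V →ₗ[K] A} (hf : Function.Bijective f) (x y w : V) :
    pullbackMul K f (pullbackMul K f x y) w = pullbackMul K f x (pullbackMul K f y w) := by
  apply hf.1
  simp only [map_pullbackMul hf, mul_assoc]

variable [CharZero K] {f : V →ₗ[K] A}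

theorem pullbackMul_one (hf : Function.Bijective (symmetrization f)) (x : SymmetricAlgebra K V) :
    pullbackMul K (symmetrization f) x 1 = x := by
  apply hf.1
  rw [map_pullbackMul hf, symmetrization_one, mul_one]

theorem pullbackMul_pow_succ (hf : Function.Bijective (symmetrization f))
    (x : SymmetricAlgebra K V) (η : V) (n : ℕ) :
    pullbackMul K (symmetrization f) x (SymmetricAlgebra.ι K V η ^ (n + 1))
      = pullbackMul K (symmetrization f)
        (pullbackMul K (symmetrization f) x (SymmetricAlgebra.ι K V η ^ n))
        (SymmetricAlgebra.ι K V η) := by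
  rw [pullbackMul_assoc hf]
  congr 1
  apply hf.1
  have h1 := symmetrization_pow f η 1
  rw [pow_one, pow_one] at h1
  rw [map_pullbackMul hf, symmetrization_pow, symmetrization_pow, h1, pow_succ]

theorem pullbackMul_divPow_ι (hf : Function.Bijective (symmetrization f)) (ξ : V) (w : ℕ → V)
    (hw : ∀ j, f (w (j + 1)) = f ξ * f (w j) - f (w j) * f ξ) (k : ℕ) :
    pullbackMul K (symmetrization f) (divPow K k ξ) (SymmetricAlgebra.ι K V (w 0))
      = ∑ p ∈ antidiagonal k,
        bern K p.2 • (divPow K p.1 ξ * SymmetricAlgebra.ι K V (w p.2)) := by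
  apply hf.1
  have h1 := symmetrization_pow f (w 0) 1
  rw [pow_one, pow_one] at h1
  rw [map_pullbackMul hf, h1, symmetrization_mul f ξ w hw]

end Pullback

/-! ### Surjectivity of $\mathfrak q$ and the Bernoulli formula -/

section PBW

variable (K : Type*) [Field K] {g : Type*} [LieRing g] [LieAlgebra K g]

theorem rescaled_lie_iterate (z : K) (ξ η : g) (j : ℕ) :
    toRescaled K z (z ^ (j + 1) • (LieAlgebra.ad K g ξ ^ (j + 1)) η)
      = ⁅toRescaled K z ξ, toRescaled K z (z ^ j • (LieAlgebra.ad K g ξ ^ j) η)⁆ := by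
  rw [rescaled_bracket, lie_smul, smul_smul, ← pow_succ', pow_succ' (LieAlgebra.ad K g ξ)]
  rfl

variable [CharZero K]

theorem quant_divPow_mul_ι (ξ η : g) (k : ℕ) :
    quant K g (divPow K k ξ) * UniversalEnvelopingAlgebra.ι K η = quant K g (∑ p ∈ antidiagonal k,
      bern K p.2 • (divPow K p.1 ξ * SymmetricAlgebra.ι K g ((LieAlgebra.ad K g ξ ^ p.2) η))) := by
  refine symmetrization_mul _ ξ (fun j => (LieAlgebra.ad K g ξ ^ j) η) (fun j => ?_) k
  rw [pow_succ', Module.End.mul_apply, LieAlgebra.ad_apply]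
  simp only [LieHom.coe_toLinearMap, LieHom.map_lie, LieRing.of_associative_ring_bracket]

/-- The range contains $1$ and is stable under right multiplication by generators: on powers this is
`quant_divPow_mul_ι`, and powers span. -/
theorem quant_surjective : Function.Surjective (quant K g) := by
  rw [← LinearMap.range_eq_top]
  have h1 : ∀ x ∈ LinearMap.range (quant K g), ∀ η : g,
      x * UniversalEnvelopingAlgebra.ι K η ∈ LinearMap.range (quant K g) := by
    rintro _ ⟨x, rfl⟩ η
    have hx : x ∈ Submodule.span K (Set.range fun p : g × ℕ => SymmetricAlgebra.ι K g p.1 ^ p.2) :=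
      span_pow_ι (K := K) (V := g) ▸ Submodule.mem_top
    induction hx using Submodule.span_induction with
    | mem _ h =>
      obtain ⟨⟨ξ, k⟩, rfl⟩ := h
      simp only
      rw [pow_ι_eq_smul_divPow, map_smul, smul_mul_assoc, quant_divPow_mul_ι]
      exact Submodule.smul_mem _ _ ⟨_, rfl⟩
    | zero => simp
    | add a b _ _ ha hb => rw [map_add, add_mul]; exact Submodule.add_mem _ ha hb
    | smul r a _ ha => rw [map_smul, smul_mul_assoc]; exact Submodule.smul_mem _ r ha
  have h2 : ∀ u : TensorAlgebra K g, ∀ x ∈ LinearMap.range (quant K g),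
      x * UniversalEnvelopingAlgebra.mkAlgHom K g u ∈ LinearMap.range (quant K g) := by
    intro u
    induction u using TensorAlgebra.induction with
    | algebraMap r =>
      intro x hx
      rw [AlgHom.commutes, ← Algebra.commutes, ← Algebra.smul_def]
      exact Submodule.smul_mem _ r hx
    | ι v => exact fun x hx => h1 x hx v
    | mul a b ha hb => intro x hx; rw [map_mul, ← mul_assoc]; exact hb _ (ha _ hx)
    | add a b ha hb => intro x hx; rw [map_add, mul_add]; exact Submodule.add_mem _ (ha _ hx) (hb _ hx)
  refine eq_top_iff.2 fun u _ => ?_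
  obtain ⟨t, rfl⟩ : ∃ t, UniversalEnvelopingAlgebra.mkAlgHom K g t = u := Quotient.exists_rep u
  have := h2 t 1 ⟨divPow K 0 0, by rw [divPow_zero, quant, symmetrization_one]⟩
  simpa using this

theorem quant_bijective : Function.Bijective (quant K g) :=
  ⟨quant_injective K, quant_surjective K⟩

/-- A linear isomorphism induces an isomorphism of symmetric algebras. This is needed because
$\mathfrak q_z$ starts from $\mathrm{Sym}(\mathfrak g)$ and not from $\mathrm{Sym}(\mathfrak g_z)$.
-/
theorem symmetrization_comp_equiv_bijective {V : Type*} [AddCommGroup V] [Module K V]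
    (φ : V ≃ₗ[K] g) :
    Function.Bijective (symmetrization ((UniversalEnvelopingAlgebra.ι K :
        g →ₗ⁅K⁆ UniversalEnvelopingAlgebra K g).toLinearMap ∘ₗ φ.toLinearMap)) := by
  set e := SymmetricAlgebra.lift (SymmetricAlgebra.ι K g ∘ₗ φ.toLinearMap) with he
  set e' := SymmetricAlgebra.lift (SymmetricAlgebra.ι K V ∘ₗ φ.symm.toLinearMap) with he'
  have h1 : e'.comp e = AlgHom.id K _ := by ext v; simp [he, he']
  have h2 : e.comp e' = AlgHom.id K _ := by ext v; simp [he, he']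
  have hb : Function.Bijective e :=
    Function.bijective_iff_has_inverse.2 ⟨e', AlgHom.congr_fun h1, AlgHom.congr_fun h2⟩
  have : symmetrization ((UniversalEnvelopingAlgebra.ι K :
        g →ₗ⁅K⁆ UniversalEnvelopingAlgebra K g).toLinearMap ∘ₗ φ.toLinearMap)
      = quant K g ∘ₗ e.toLinearMap := by
    refine linearMap_ext_pow fun v n => ?_
    rw [LinearMap.comp_apply, symmetrization_pow, AlgHom.toLinearMap_apply, map_pow, he,
      SymmetricAlgebra.lift_ι_apply, LinearMap.comp_apply, LinearMap.comp_apply, quant,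
      symmetrization_pow]
  rw [this]
  exact (quant_bijective K).comp hb

theorem quantRescaled_bijective (z : K) : Function.Bijective (quantRescaled K g z) :=
  symmetrization_comp_equiv_bijective K (g := Rescaled z g) (V := g) (toRescaled K z)

theorem pbwStar_divPow_ι (z : K) (ξ η : g) (k : ℕ) :
    pbwStar K z (divPow K k ξ) (SymmetricAlgebra.ι K g η) = ∑ p ∈ antidiagonal k,
      (bern K p.2 * z ^ p.2) •
        (divPow K p.1 ξ * SymmetricAlgebra.ι K g ((LieAlgebra.ad K g ξ ^ p.2) η)) := by
  have h := pullbackMul_divPow_ι (quantRescaled_bijective K (g := g) z) ξ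
    (fun j => z ^ j • (LieAlgebra.ad K g ξ ^ j) η)
    (fun j => by
      simp only [LinearMap.comp_apply, LinearEquiv.coe_coe]
      rw [rescaled_lie_iterate, LieHom.coe_toLinearMap, LieHom.map_lie,
        LieRing.of_associative_ring_bracket]) k
  simp only [pow_zero, one_smul, Module.End.one_apply, map_smul, mul_smul_comm, smul_smul] at h
  exact h

/-- The star product for `z = 1`, without rescaling. -/
theorem pullbackMul_quant_divPow_ι (ξ η : g) (k : ℕ) :
    pullbackMul K (quant K g) (divPow K k ξ) (SymmetricAlgebra.ι K g η) = ∑ p ∈ antidiagonal k,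
      bern K p.2 •
        (divPow K p.1 ξ * SymmetricAlgebra.ι K g ((LieAlgebra.ad K g ξ ^ p.2) η)) :=
  pullbackMul_divPow_ι (quant_bijective K (g := g)) ξ (fun j => (LieAlgebra.ad K g ξ ^ j) η)
    (fun j => by
      rw [pow_succ', Module.End.mul_apply, LieAlgebra.ad_apply]
      simp only [LieHom.coe_toLinearMap, LieHom.map_lie, LieRing.of_associative_ring_bracket]) k

end PBW

/-! ### Weighting homogeneous parts by powers of $z$ -/

section Homogenization

variable (K : Type*) [Field K] {V : Type*} [AddCommGroup V] [Module K V]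

/-- The linear map which multiplies the homogeneous part of degree `i` by `z ^ (d - i)`, for
`i ≤ d`, and kills the parts of degree greater than `d`. -/
def homogenize (z : K) (d : ℕ) : SymmetricAlgebra K V →ₗ[K] SymmetricAlgebra K V :=
  ∑ i ∈ Finset.range (d + 1), z ^ (d - i) • homPart K i

variable {K}

theorem homPart_of_grade {x : SymmetricAlgebra K V} {k : ℕ}
    (h : grade K x = Polynomial.monomial k x) (n : ℕ) : homPart K n x = if k = n then x else 0 := by
  rw [homPart_apply, h, Polynomial.coeff_monomial]

theorem homogenize_of_grade {x : SymmetricAlgebra K V} {k : ℕ}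
    (h : grade K x = Polynomial.monomial k x) (z : K) {d : ℕ} (hd : k ≤ d) :
    homogenize K z d x = z ^ (d - k) • x := by
  simp only [homogenize, LinearMap.sum_apply, LinearMap.smul_apply, homPart_of_grade h]
  rw [Finset.sum_eq_single k]
  · simp
  · intro i _ hi; simp [hi.symm]
  · intro hk; simp at hk; omega

theorem grade_divPow_mul_ι (n : ℕ) (v w : V) :
    grade K (divPow K n v * SymmetricAlgebra.ι K V w)
      = Polynomial.monomial (n + 1) (divPow K n v * SymmetricAlgebra.ι K V w) := by
  rw [map_mul, grade_divPow, grade_ι, Polynomial.monomial_mul_monomial]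

variable (K V) in
/-- The elements of the symmetric algebra of degree at most `d`. -/
def degreeLE (d : ℕ) : Submodule K (SymmetricAlgebra K V) :=
  Submodule.span K {x | ∃ k ≤ d, ∃ v, divPow K k v = x}

theorem divPow_mem_degreeLE {k d : ℕ} (h : k ≤ d) (v : V) : divPow K k v ∈ degreeLE K V d :=
  Submodule.subset_span ⟨k, h, v, rfl⟩

theorem divPow_mul_ι_mem_degreeLE [CharZero K] {k d : ℕ} (h : k ≤ d) (v w : V) :
    divPow K k v * SymmetricAlgebra.ι K V w ∈ degreeLE K V (d + 1) := by
  rw [divPow, smul_mul_assoc]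
  refine Submodule.smul_mem _ _ (pow_mul_ι_mem _ _ (fun u => ?_) _ _)
  rw [pow_ι_eq_smul_divPow]
  exact Submodule.smul_mem _ _ (divPow_mem_degreeLE (by omega) u)

end Homogenization

/-! ### The Gutt star product is the product pulled back from $U(\mathfrak g_z)$ -/

section GuttEqPBW

variable {K : Type*} [Field K] [CharZero K] {g : Type*} [LieRing g] [LieAlgebra K g]

/-- On $\xi^k$, the term with $j$ brackets has degree $k+1-j$ and so receives
$z^{(d+1)-(k+1-j)}=z^{d-k}z^j$, exactly its weight in the formula for $\mathfrak g_z$. The degree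
bound is carried along for the induction on powers of $\eta$. -/
theorem homogenize_mul_ι (z : K) (d : ℕ) {x : SymmetricAlgebra K g} (hx : x ∈ degreeLE K g d)
    (η : g) :
    pullbackMul K (quant K g) x (SymmetricAlgebra.ι K g η) ∈ degreeLE K g (d + 1) ∧
    homogenize K z (d + 1) (pullbackMul K (quant K g) x (SymmetricAlgebra.ι K g η))
      = pbwStar K z (homogenize K z d x) (SymmetricAlgebra.ι K g η) := by
  induction hx using Submodule.span_induction with
  | mem x h =>
    obtain ⟨k, hk, ξ, rfl⟩ := h
    rw [pullbackMul_quant_divPow_ι]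
    refine ⟨Submodule.sum_mem _ fun p hp => Submodule.smul_mem _ _
      (divPow_mul_ι_mem_degreeLE ?_ _ _), ?_⟩
    · rw [Finset.HasAntidiagonal.mem_antidiagonal] at hp; omega
    · rw [homogenize_of_grade (grade_divPow K k ξ) z hk, map_smul, LinearMap.smul_apply,
        pbwStar_divPow_ι, map_sum, Finset.smul_sum]
      refine Finset.sum_congr rfl fun p hp => ?_
      rw [Finset.HasAntidiagonal.mem_antidiagonal] at hp
      rw [map_smul, homogenize_of_grade (grade_divPow_mul_ι _ _ _) z (by omega), smul_smul,
        smul_smul, mul_left_comm, ← pow_add]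
      congr 3
      omega
  | zero => simp
  | add a b _ _ ha hb =>
    simp only [map_add, LinearMap.add_apply]
    exact ⟨Submodule.add_mem _ ha.1 hb.1, by rw [ha.2, hb.2]⟩
  | smul r a _ ha =>
    simp only [map_smul, LinearMap.smul_apply]
    exact ⟨Submodule.smul_mem _ r ha.1, by rw [ha.2]⟩

theorem homogenize_mul_pow (z : K) (d : ℕ) {x : SymmetricAlgebra K g} (hx : x ∈ degreeLE K g d)
    (η : g) (n : ℕ) :
    pullbackMul K (quant K g) x (SymmetricAlgebra.ι K g η ^ n) ∈ degreeLE K g (d + n) ∧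
    homogenize K z (d + n) (pullbackMul K (quant K g) x (SymmetricAlgebra.ι K g η ^ n))
      = pbwStar K z (homogenize K z d x) (SymmetricAlgebra.ι K g η ^ n) := by
  induction n with
  | zero =>
    have h1 := pullbackMul_one (quant_bijective K (g := g)) x
    have h2 := pullbackMul_one (quantRescaled_bijective K (g := g) z) (homogenize K z d x)
    rw [pow_zero, add_zero]
    exact ⟨by rw [quant, h1]; exact hx, by rw [quant, h1]; exact h2.symm⟩
  | succ n ih =>
    have h1 := pullbackMul_pow_succ (quant_bijective K (g := g)) x η n
    have h2 := pullbackMul_pow_succ (quantRescaled_bijective K (g := g) z) (homogenize K z d x) η n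
    have h3 := homogenize_mul_ι z (d + n) ih.1 η
    rw [ih.2] at h3
    refine ⟨?_, ?_⟩
    · rw [quant, h1]; exact h3.1
    · rw [quant, h1]; exact h3.2.trans h2.symm

/-- Every term of the Bernoulli formula has a factor from $\mathfrak g$. This explains why the sum
defining $\star_z$ may stop at $n=k+\ell-1$. -/
theorem homPart_zero_pullbackMul_ι (x : SymmetricAlgebra K g) (η : g) :
    homPart K 0 (pullbackMul K (quant K g) x (SymmetricAlgebra.ι K g η)) = 0 := by
  have : homPart K 0 ∘ₗ (pullbackMul K (quant K g)).flip (SymmetricAlgebra.ι K g η) = 0 := by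
    refine linearMap_ext_divPow fun ξ k => ?_
    rw [LinearMap.comp_apply, LinearMap.flip_apply, pullbackMul_quant_divPow_ι, map_sum,
      LinearMap.zero_apply]
    refine Finset.sum_eq_zero fun p _ => ?_
    rw [map_smul, homPart_of_grade (grade_divPow_mul_ι _ _ _), if_neg (by omega), smul_zero]
  exact LinearMap.congr_fun this x

theorem guttHom_divPow_pow (z : K) (k n : ℕ) (ξ η : g) :
    guttHom K z k n (divPow K k ξ) (SymmetricAlgebra.ι K g η ^ n)
      = pbwStar K z (divPow K k ξ) (SymmetricAlgebra.ι K g η ^ n) := by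
  have h := (homogenize_mul_pow z k (divPow_mem_degreeLE le_rfl ξ) η n).2
  rw [homogenize_of_grade (grade_divPow K k ξ) z le_rfl, Nat.sub_self, pow_zero, one_smul] at h
  rw [← h, homogenize, ← Finset.sum_range_reflect]
  simp only [guttHom, LinearMap.sum_apply, LinearMap.smul_apply, LinearMap.compr₂_apply]
  have h0 : k + n ≠ 0 → homPart K 0 (pullbackMul K (quant K g) (divPow K k ξ)
      (SymmetricAlgebra.ι K g η ^ n)) = 0 := by
    intro hkn
    cases n with
    | zero =>
      have h1 := pullbackMul_one (quant_bijective K (g := g)) (divPow K k ξ)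
      rw [pow_zero, quant, h1, homPart_divPow, if_neg (by omega)]
    | succ n =>
      have h1 := pullbackMul_pow_succ (quant_bijective K (g := g)) (divPow K k ξ) η n
      rw [quant, h1]
      exact homPart_zero_pullbackMul_ι _ η
  -- For $k=n=0$ the truncated range consists of the single term that `homogenize` also has.
  -- Otherwise `homogenize` has one more term, that of degree $0$, which vanishes.
  rcases Nat.eq_zero_or_pos (k + n) with hkn | hkn
  · simp [hkn]
  · rw [Finset.sum_range_succ, Nat.add_sub_cancel, Nat.sub_self, h0 hkn.ne', smul_zero, add_zero]
    refine Finset.sum_congr (by ext; simp; omega) fun m hm => ?_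
    rw [Finset.mem_range] at hm
    congr 2
    omega

theorem guttStar_eq_pbwStar (z : K) : guttStar K z (g := g) = pbwStar K z := by
  refine linearMap_ext_divPow fun ξ k => linearMap_ext_pow fun η n => ?_
  rw [← guttHom_divPow_pow]
  change (grade K (divPow K k ξ)).sum (fun k xk => (grade K (SymmetricAlgebra.ι K g η ^ n)).sum
    fun l yl => guttHom K z k l xk yl) = _
  rw [grade_divPow, grade_pow_ι, Polynomial.sum_monomial_index _ _ (by simp [Polynomial.sum]),
    Polynomial.sum_monomial_index _ _ (by simp)]

theorem guttStar_pow_ι (z : K) (k : ℕ) (ξ η : g) :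
    guttStar K z (SymmetricAlgebra.ι K g ξ ^ k) (SymmetricAlgebra.ι K g η) =
      ∑ j ∈ Finset.range (k + 1),
        ((k.choose j : K) * z ^ j * ((bernoulli' j : ℚ) : K)) •
          (SymmetricAlgebra.ι K g ξ ^ (k - j) *
            SymmetricAlgebra.ι K g ((LieAlgebra.ad K g ξ ^ j) η)) := by
  rw [guttStar_eq_pbwStar, pow_ι_eq_smul_divPow, map_smul, LinearMap.smul_apply, pbwStar_divPow_ι,
    ← Finset.Nat.sum_antidiagonal_swap, Finset.smul_sum]
  simp only [Prod.fst_swap, Prod.snd_swap]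
  rw [Finset.Nat.sum_antidiagonal_eq_sum_range_succ (fun i j => (k.factorial : K) •
    (bern K i * z ^ i) • (divPow K j ξ * SymmetricAlgebra.ι K g ((LieAlgebra.ad K g ξ ^ i) η)))]
  refine Finset.sum_congr rfl fun j hj => ?_
  rw [divPow, smul_mul_assoc, smul_smul, smul_smul, bern_eq,
    Nat.cast_choose K (Nat.lt_succ_iff.1 (Finset.mem_range.1 hj))]
  congr 1
  have h1 := Nat.cast_ne_zero (R := K).2 j.factorial_ne_zero
  have h2 := Nat.cast_ne_zero (R := K).2 (k - j).factorial_ne_zero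
  field_simp

end GuttEqPBW

/-! ### Exponential and logarithm as inverse power series -/

section ExpLog

variable (K : Type*) [Field K] [CharZero K]

open PowerSeries

/-- Here `log` is the series of $\log(1+X)$. By the chain rule both sides have derivative $1$, and
both have zero constant term. -/
theorem log_subst_exp_sub_one : (log K).subst (exp K - 1) = X := by
  have hs : HasSubst (exp K - 1) := HasSubst.exp_sub_one
  apply PowerSeries.derivative.ext
  · rw [derivative_subst hs, derivative_X, map_sub, derivative_exp, derivative_one, sub_zero]
    have h : d⁄dX K (log K) * (1 + X) = 1 := by
      ext n
      rw [deriv_log, mul_add, mul_one, map_add]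
      cases n with
      | zero => simp
      | succ n => rw [coeff_succ_mul_X, coeff_mk, coeff_mk, coeff_one]; simp [pow_succ]
    have h2 := congrArg (fun p => PowerSeries.subst (exp K - 1) p) h
    rw [subst_mul hs, subst_add hs, subst_X hs, ← map_one (C (R := K)), subst_C] at h2
    simpa using h2
  · rw [constantCoeff_X]
    exact constantCoeff_subst_eq_zero (by
      change PowerSeries.constantCoeff (exp K - 1) = 0; simp [constantCoeff_exp]) _ constantCoeff_log

/-- The series $e^X-1$ has an inverse for substitution, and the left inverse $\log(1+X)$ must
coincide with it. -/
theorem exp_subst_log : (exp K).subst (log K) = 1 + X := by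
  have hs : HasSubst (exp K - 1) := HasSubst.exp_sub_one
  have hl : HasSubst (log K) := HasSubst.log
  set P : PowerSeries K := exp K - 1 with hP
  have hP0 : P.constantCoeff = 0 := by simp [hP, constantCoeff_exp]
  have hP1 : IsUnit (P.coeff 1) := by simp [hP, coeff_exp, coeff_one]
  have hr := subst_substInvOfIsUnit_right P hP0 hP1
  have hQ : HasSubst (P.substInvOfIsUnit hP1) := HasSubst.substInvOfIsUnit P hP1
  have he : log K = P.substInvOfIsUnit hP1 := by
    have h := congrArg (fun p => PowerSeries.subst (P.substInvOfIsUnit hP1) p)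
      (log_subst_exp_sub_one K)
    rwa [← hP, subst_comp_subst_apply hs hQ, hr, subst_X hQ, X_subst] at h
  rw [← he, hP, subst_sub hl, ← map_one (C (R := K)), subst_C] at hr
  rw [sub_eq_iff_eq_add.1 hr, add_comm]
  simp

/-- The power series `log (1 + X) / X`. -/
def logDiv : PowerSeries K := mk fun n => (-1) ^ n / (n + 1)

/-- The power series `(exp X - 1) / X`. -/
def expDiv : PowerSeries K := mk fun n => ((n + 1).factorial : K)⁻¹

theorem X_mul_logDiv : X * logDiv K = log K := by
  ext n
  cases n with
  | zero => simp
  | succ n => rw [coeff_succ_X_mul, logDiv, coeff_mk]; simp [pow_succ]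

theorem X_mul_expDiv : X * expDiv K = exp K - 1 := by
  ext n
  cases n with
  | zero => simp
  | succ n => rw [coeff_succ_X_mul, expDiv, coeff_mk]; simp [coeff_exp, coeff_one]

/-- This is $\log(1+(e^X-1))=X$ divided by $X$. It serves to invert
$(e^{\mathrm{ad}\,Z}-1)/\mathrm{ad}\,Z$. -/
theorem logDiv_subst_mul_expDiv : (logDiv K).subst (exp K - 1) * expDiv K = 1 := by
  have hs : HasSubst (exp K - 1) := HasSubst.exp_sub_one
  have h := log_subst_exp_sub_one K
  rw [← X_mul_logDiv, subst_mul hs, subst_X hs, ← X_mul_expDiv, mul_assoc] at h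
  refine mul_left_cancel₀ (X_ne_zero (R := K)) ?_
  rw [mul_one, X_mul_expDiv] at *
  rw [mul_comm (expDiv K)] at h
  exact h

end ExpLog

/-! ### Power series in operators that raise the order -/

section FunctionalCalculus

variable {K : Type*} [Field K] {A : Type*} [Ring A] [Algebra K A]

/-- All coefficients of `f` of total degree less than `n` vanish. -/
def VanishBelow (n : ℕ) (f : MvPowerSeries (Fin 2) A) : Prop :=
  ∀ d, Finsupp.degree d < n → MvPowerSeries.coeff d f = 0

theorem VanishBelow.mul {m n : ℕ} {f h : MvPowerSeries (Fin 2) A} (hf : VanishBelow m f)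
    (hh : VanishBelow n h) : VanishBelow (m + n) (f * h) := by
  classical
  intro d hd
  rw [MvPowerSeries.coeff_mul]
  refine Finset.sum_eq_zero fun p hp => ?_
  rw [Finset.HasAntidiagonal.mem_antidiagonal] at hp
  rw [← hp, map_add] at hd
  rcases lt_or_ge (Finsupp.degree p.1) m with h1 | h1
  · rw [hf _ h1, zero_mul]
  · rw [hh _ (by omega), mul_zero]

theorem vanishBelow_zero (f : MvPowerSeries (Fin 2) A) : VanishBelow 0 f := fun _ h => by simp at h

/-- Linear operators which raise the order of power series. -/
def IsRaising (T : Module.End K (MvPowerSeries (Fin 2) A)) : Prop :=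
  ∀ n f, VanishBelow n f → VanishBelow (n + 1) (T f)

theorem IsRaising.pow_apply {T : Module.End K (MvPowerSeries (Fin 2) A)} (hT : IsRaising T) {n : ℕ}
    {f : MvPowerSeries (Fin 2) A} (hf : VanishBelow n f) (i : ℕ) :
    VanishBelow (n + i) ((T ^ i) f) := by
  induction i with
  | zero => simpa using hf
  | succ i ih => rw [pow_succ', Module.End.mul_apply]; exact hT _ _ ih

theorem coeff_smul' (c : K) (f : MvPowerSeries (Fin 2) A) (d : Fin 2 →₀ ℕ) :
    MvPowerSeries.coeff d (c • f) = c • MvPowerSeries.coeff d f := rfl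

/-- The value of a power series at a linear operator (which should raise the order). -/
def opEval (T : Module.End K (MvPowerSeries (Fin 2) A)) (p : PowerSeries K) :
    Module.End K (MvPowerSeries (Fin 2) A) where
  toFun f := fun d => ∑ i ∈ Finset.range (Finsupp.degree d + 1),
    PowerSeries.coeff i p • MvPowerSeries.coeff d ((T ^ i) f)
  map_add' f h := by
    funext d
    simp only [map_add, smul_add, Finset.sum_add_distrib]
    rfl
  map_smul' c f := by
    funext d
    simp only [map_smul, coeff_smul', smul_comm _ c, ← Finset.smul_sum]
    rfl

theorem coeff_opEval (T : Module.End K (MvPowerSeries (Fin 2) A)) (p : PowerSeries K)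
    (f : MvPowerSeries (Fin 2) A) (d : Fin 2 →₀ ℕ) :
    MvPowerSeries.coeff d (opEval T p f) = ∑ i ∈ Finset.range (Finsupp.degree d + 1),
      PowerSeries.coeff i p • MvPowerSeries.coeff d ((T ^ i) f) := rfl

/-- `opEval` cuts its sum off at the degree of the coefficient read. Nothing is lost, since $T^i f$
has no coefficients of degree below $i$, so partial sums approximate to any order. -/
theorem vanishBelow_sub_opEval {T : Module.End K (MvPowerSeries (Fin 2) A)} (hT : IsRaising T)
    (p : PowerSeries K) (f : MvPowerSeries (Fin 2) A) (N : ℕ) :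
    VanishBelow N (opEval T p f - ∑ i ∈ Finset.range N, PowerSeries.coeff i p • (T ^ i) f) := by
  intro d hd
  simp only [map_sub, coeff_opEval, map_sum, coeff_smul']
  rw [sub_eq_zero]
  refine Finset.sum_subset (fun i hi => by simp at hi ⊢; omega) fun i _ hi => ?_
  rw [hT.pow_apply (vanishBelow_zero f) i d (by simp at hi; omega), smul_zero]

theorem sum_range_antidiagonal {M : Type*} [AddCommMonoid M] (N : ℕ) (F : ℕ → ℕ → M)
    (hF : ∀ i j, N < i + j → F i j = 0) :
    ∑ i ∈ Finset.range (N + 1), ∑ j ∈ Finset.range (N + 1), F i j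
      = ∑ n ∈ Finset.range (N + 1), ∑ p ∈ antidiagonal n, F p.1 p.2 := by
  rw [← Finset.sum_product', Finset.sum_sigma']
  symm
  refine Finset.sum_of_injOn (fun x => x.2) ?_ ?_ ?_ ?_
  · rintro ⟨n, a, b⟩ h ⟨m, c, d⟩ h' e
    simp only [Finset.coe_sigma, Set.mem_sigma_iff, Finset.mem_coe,
      Finset.HasAntidiagonal.mem_antidiagonal] at h h' e
    obtain ⟨_, rfl⟩ := h
    obtain ⟨_, rfl⟩ := h'
    cases e
    rfl
  · rintro ⟨n, a, b⟩ h
    simp only [Finset.coe_sigma, Set.mem_sigma_iff, Finset.mem_coe, Finset.mem_range,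
      Finset.HasAntidiagonal.mem_antidiagonal, Finset.mem_product] at h ⊢
    omega
  · rintro ⟨a, b⟩ _ h
    apply hF
    by_contra hab
    exact h ⟨⟨a + b, a, b⟩, by simp; omega, rfl⟩
  · rintro ⟨n, a, b⟩ _
    rfl

theorem coeff_opEval_opEval {S T : Module.End K (MvPowerSeries (Fin 2) A)} (hS : IsRaising S)
    (hT : IsRaising T) (p q : PowerSeries K) (f : MvPowerSeries (Fin 2) A) (d : Fin 2 →₀ ℕ) :
    MvPowerSeries.coeff d (opEval S p (opEval T q f))
      = ∑ n ∈ Finset.range (Finsupp.degree d + 1), ∑ r ∈ antidiagonal n,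
        (PowerSeries.coeff r.1 p * PowerSeries.coeff r.2 q) •
          MvPowerSeries.coeff d ((S ^ r.1) ((T ^ r.2) f)) := by
  rw [← sum_range_antidiagonal _ (fun i j => (PowerSeries.coeff i p * PowerSeries.coeff j q) •
          MvPowerSeries.coeff d ((S ^ i) ((T ^ j) f))), coeff_opEval]
  · refine Finset.sum_congr rfl fun i _ => ?_
    have h := hS.pow_apply (vanishBelow_sub_opEval hT q f (Finsupp.degree d + 1)) i d (by omega)
    rw [map_sub, map_sub, sub_eq_zero] at h
    rw [h]
    simp only [map_sum, map_smul, coeff_smul', Finset.smul_sum, smul_smul]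
  · intro i j hij
    rw [hS.pow_apply (hT.pow_apply (vanishBelow_zero f) j) i d (by omega), smul_zero]

theorem opEval_mul {T : Module.End K (MvPowerSeries (Fin 2) A)} (hT : IsRaising T)
    (p q : PowerSeries K) : opEval T (p * q) = opEval T p * opEval T q := by
  refine LinearMap.ext fun f => MvPowerSeries.ext fun d => ?_
  rw [Module.End.mul_apply, coeff_opEval_opEval hT hT, coeff_opEval]
  refine Finset.sum_congr rfl fun n _ => ?_
  rw [PowerSeries.coeff_mul, Finset.sum_smul]
  refine Finset.sum_congr rfl fun r hr => ?_
  rw [Finset.HasAntidiagonal.mem_antidiagonal] at hr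
  rw [← hr, pow_add, Module.End.mul_apply]

theorem opEval_one (T : Module.End K (MvPowerSeries (Fin 2) A)) : opEval T 1 = 1 := by
  refine LinearMap.ext fun f => MvPowerSeries.ext fun d => ?_
  rw [coeff_opEval, Finset.sum_eq_single 0]
  · simp
  · intro i _ hi; simp [PowerSeries.coeff_one, hi]
  · simp

theorem opEval_add (T : Module.End K (MvPowerSeries (Fin 2) A)) (p q : PowerSeries K) :
    opEval T (p + q) = opEval T p + opEval T q := by
  refine LinearMap.ext fun f => MvPowerSeries.ext fun d => ?_
  simp only [coeff_opEval, map_add, add_smul, Finset.sum_add_distrib, LinearMap.add_apply]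

theorem opEval_X {T : Module.End K (MvPowerSeries (Fin 2) A)} (hT : IsRaising T) :
    opEval T PowerSeries.X = T := by
  refine LinearMap.ext fun f => MvPowerSeries.ext fun d => ?_
  rw [coeff_opEval, Finset.sum_eq_single 1]
  · simp
  · intro i _ hi; simp [PowerSeries.coeff_X, hi]
  · intro h
    have := hT 0 f (vanishBelow_zero f) d (by simp at h; simp [h])
    simp [this]

theorem opEval_pow {T : Module.End K (MvPowerSeries (Fin 2) A)} (hT : IsRaising T)
    (p : PowerSeries K) (n : ℕ) : opEval T (p ^ n) = opEval T p ^ n := by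
  induction n with
  | zero => simp [opEval_one]
  | succ n ih => rw [pow_succ, opEval_mul hT, ih, pow_succ]

/-- Powers of $p$ have order at least their exponent, so in each degree the substitution is a finite
sum and the two summations can be exchanged. -/
theorem opEval_opEval {T : Module.End K (MvPowerSeries (Fin 2) A)} (hT : IsRaising T)
    {p : PowerSeries K} (hp : PowerSeries.constantCoeff p = 0) (q : PowerSeries K) :
    opEval (opEval T p) q = opEval T (q.subst p) := by
  refine LinearMap.ext fun f => MvPowerSeries.ext fun d => ?_
  have hs : PowerSeries.HasSubst p := PowerSeries.HasSubst.of_constantCoeff_zero' hp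
  have hc : ∀ n ≤ Finsupp.degree d, PowerSeries.coeff n (q.subst p)
      = ∑ i ∈ Finset.range (Finsupp.degree d + 1),
        PowerSeries.coeff i q * PowerSeries.coeff n (p ^ i) := by
    intro n hn
    rw [PowerSeries.coeff_subst' hs, finsum_eq_sum_of_support_subset]
    · rfl
    · intro i hi
      by_contra h
      simp only [Finset.coe_range, Set.mem_Iio, not_lt] at h
      refine hi ?_
      have h0 : PowerSeries.coeff n (p ^ i) = 0 := by
        refine PowerSeries.coeff_of_lt_order _ (lt_of_lt_of_le ?_
          (PowerSeries.le_order_pow_of_constantCoeff_eq_zero i hp))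
        exact_mod_cast (by omega : n < i)
      change PowerSeries.coeff i q • PowerSeries.coeff n (p ^ i) = 0
      rw [h0, smul_zero]
  rw [coeff_opEval, coeff_opEval]
  simp only [← opEval_pow hT, coeff_opEval, Finset.smul_sum]
  rw [Finset.sum_comm]
  refine Finset.sum_congr rfl fun n hn => ?_
  rw [hc n (by simp at hn; omega), Finset.sum_smul]
  simp only [smul_smul]

theorem IsRaising.sub {S T : Module.End K (MvPowerSeries (Fin 2) A)} (hS : IsRaising S)
    (hT : IsRaising T) : IsRaising (S - T) := fun n f hf d hd => by
  rw [LinearMap.sub_apply, map_sub, hS n f hf d hd, hT n f hf d hd, sub_zero]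

theorem opEval_exp_add [CharZero K] {S T : Module.End K (MvPowerSeries (Fin 2) A)}
    (hS : IsRaising S) (hT : IsRaising T) (h : Commute S T) :
    opEval (S + T) (PowerSeries.exp K)
      = opEval S (PowerSeries.exp K) * opEval T (PowerSeries.exp K) := by
  refine LinearMap.ext fun f => MvPowerSeries.ext fun d => ?_
  rw [Module.End.mul_apply, coeff_opEval_opEval hS hT, coeff_opEval]
  refine Finset.sum_congr rfl fun n _ => ?_
  have := congrArg (fun T : Module.End K _ => MvPowerSeries.coeff d (T f))
    (inv_factorial_smul_add_pow K h n)
  simp only [LinearMap.smul_apply, coeff_smul', LinearMap.sum_apply, map_sum,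
    Module.End.mul_apply, map_smul, smul_smul] at this
  simpa [PowerSeries.coeff_exp, mul_comm] using this

theorem opEval_zero (p : PowerSeries K) :
    opEval (0 : Module.End K (MvPowerSeries (Fin 2) A)) p = PowerSeries.constantCoeff p • 1 := by
  refine LinearMap.ext fun f => MvPowerSeries.ext fun d => ?_
  rw [coeff_opEval, Finset.sum_eq_single 0]
  · simp
  · intro i _ hi; simp [zero_pow hi]
  · simp

end FunctionalCalculus

/-! ### The differential equation of $\log(e^x e^y)$ -/

section FormalExp

variable (K : Type*) [Field K] {A : Type*} [Ring A] [Algebra K A]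

theorem isRaising_mulLeft {u : MvPowerSeries (Fin 2) A} (hu : VanishBelow 1 u) :
    IsRaising (LinearMap.mulLeft K u) := fun n f hf => by
  rw [add_comm]; exact hu.mul hf

theorem isRaising_mulRight {u : MvPowerSeries (Fin 2) A} (hu : VanishBelow 1 u) :
    IsRaising (LinearMap.mulRight K u) := fun _ _ hf => hf.mul hu

/-- The commutator with a formal power series. -/
def adOp (u : MvPowerSeries (Fin 2) A) : Module.End K (MvPowerSeries (Fin 2) A) :=
  LinearMap.mulLeft K u - LinearMap.mulRight K u

theorem adOp_apply (u w : MvPowerSeries (Fin 2) A) : adOp K u w = u * w - w * u := rfl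

theorem isRaising_adOp {u : MvPowerSeries (Fin 2) A} (hu : VanishBelow 1 u) :
    IsRaising (adOp K u) :=
  (isRaising_mulLeft K hu).sub (isRaising_mulRight K hu)

variable {K}

/-- The value of a power series in one variable at a formal power series without constant term. -/
def elemEval (u : MvPowerSeries (Fin 2) A) (p : PowerSeries K) : MvPowerSeries (Fin 2) A :=
  opEval (LinearMap.mulLeft K u) p 1

theorem coeff_elemEval (u : MvPowerSeries (Fin 2) A) (p : PowerSeries K) (d : Fin 2 →₀ ℕ) :
    MvPowerSeries.coeff d (elemEval u p) = ∑ i ∈ Finset.range (Finsupp.degree d + 1),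
      PowerSeries.coeff i p • MvPowerSeries.coeff d (u ^ i) := by
  simp [elemEval, coeff_opEval, LinearMap.pow_mulLeft]

theorem vanishBelow_sub_elemEval {u : MvPowerSeries (Fin 2) A} (hu : VanishBelow 1 u)
    (p : PowerSeries K) (N : ℕ) :
    VanishBelow N (elemEval u p - ∑ i ∈ Finset.range N, PowerSeries.coeff i p • u ^ i) := by
  simpa [LinearMap.pow_mulLeft, elemEval] using vanishBelow_sub_opEval (isRaising_mulLeft K hu) p 1 N

theorem opEval_mulLeft {u : MvPowerSeries (Fin 2) A} (hu : VanishBelow 1 u) (p : PowerSeries K)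
    (f : MvPowerSeries (Fin 2) A) : opEval (LinearMap.mulLeft K u) p f = elemEval u p * f := by
  refine MvPowerSeries.ext fun d => ?_
  have h := (vanishBelow_sub_elemEval hu p (Finsupp.degree d + 1)).mul (vanishBelow_zero f) d
    (by omega)
  rw [sub_mul, map_sub, sub_eq_zero] at h
  rw [h, coeff_opEval, Finset.sum_mul, map_sum]
  refine Finset.sum_congr rfl fun i _ => ?_
  rw [smul_mul_assoc, coeff_smul', LinearMap.pow_mulLeft, LinearMap.mulLeft_apply]

theorem opEval_mulRight {u : MvPowerSeries (Fin 2) A} (hu : VanishBelow 1 u) (p : PowerSeries K)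
    (f : MvPowerSeries (Fin 2) A) : opEval (LinearMap.mulRight K u) p f = f * elemEval u p := by
  refine MvPowerSeries.ext fun d => ?_
  have h := (vanishBelow_zero f).mul (vanishBelow_sub_elemEval hu p (Finsupp.degree d + 1)) d
    (by omega)
  rw [mul_sub, map_sub, sub_eq_zero] at h
  rw [h, coeff_opEval, Finset.mul_sum, map_sum]
  refine Finset.sum_congr rfl fun i _ => ?_
  rw [mul_smul_comm, coeff_smul', LinearMap.pow_mulRight, LinearMap.mulRight_apply]

/-- The Euler derivation of formal power series. -/
def euler : Module.End K (MvPowerSeries (Fin 2) A) where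
  toFun f := fun d => ((Finsupp.degree d : ℕ) : K) • MvPowerSeries.coeff d f
  map_add' f h := by funext d; simp only [map_add, smul_add]; rfl
  map_smul' c f := by funext d; simp only [coeff_smul', smul_comm _ c]; rfl

theorem coeff_euler (f : MvPowerSeries (Fin 2) A) (d : Fin 2 →₀ ℕ) :
    MvPowerSeries.coeff d (euler (K := K) f) = ((Finsupp.degree d : ℕ) : K) • MvPowerSeries.coeff d f :=
  rfl

theorem euler_mul (f h : MvPowerSeries (Fin 2) A) :
    euler (K := K) (f * h) = euler (K := K) f * h + f * euler (K := K) h := by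
  classical
  refine MvPowerSeries.ext fun d => ?_
  rw [coeff_euler, map_add, MvPowerSeries.coeff_mul, MvPowerSeries.coeff_mul,
    MvPowerSeries.coeff_mul, ← Finset.sum_add_distrib, Finset.smul_sum]
  refine Finset.sum_congr rfl fun p hp => ?_
  rw [Finset.HasAntidiagonal.mem_antidiagonal] at hp
  rw [coeff_euler, coeff_euler, smul_mul_assoc, mul_smul_comm, ← add_smul, ← hp, map_add,
    Nat.cast_add]

theorem euler_one : euler (K := K) (1 : MvPowerSeries (Fin 2) A) = 0 := by
  have := euler_mul (K := K) (1 : MvPowerSeries (Fin 2) A) 1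
  simpa using this

theorem euler_pow_succ (f : MvPowerSeries (Fin 2) A) (n : ℕ) :
    euler (K := K) (f ^ (n + 1))
      = ∑ p ∈ antidiagonal n, f ^ p.1 * euler (K := K) f * f ^ p.2 := by
  induction n with
  | zero => simp
  | succ n ih =>
    rw [pow_succ', euler_mul, ih, Finset.Nat.antidiagonal_succ, Finset.sum_cons, Finset.sum_map,
      Finset.mul_sum]
    simp [pow_succ', mul_assoc]

theorem vanishBelow_euler (f : MvPowerSeries (Fin 2) A) : VanishBelow 1 (euler (K := K) f) := by
  intro d hd
  rw [coeff_euler]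
  simp [show Finsupp.degree d = 0 by omega]

theorem commute_mulLeft_mulRight (u w : MvPowerSeries (Fin 2) A) :
    Commute (LinearMap.mulLeft K u) (LinearMap.mulRight K w) :=
  LinearMap.ext fun f => by simp [mul_assoc]

variable [CharZero K]

/-- The degree $n$ part of $\frac{e^{X_0}-e^{X_1}}{X_0-X_1}=e^{X_1}\,\frac{e^{X_0-X_1}-1}{X_0-X_1}$,
from the binomial expansion of $X_0=X_1+(X_0-X_1)$. -/
theorem sum_antidiagonal_pow_eq (n : ℕ) :
    ((n + 1).factorial : K)⁻¹ • ∑ p ∈ antidiagonal n,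
      (MvPolynomial.X 0 ^ p.1 * MvPolynomial.X 1 ^ p.2 : MvPolynomial (Fin 2) K)
    = ∑ p ∈ antidiagonal n, ((p.1.factorial : K)⁻¹ * ((p.2 + 1).factorial : K)⁻¹) •
      ((MvPolynomial.X 0 - MvPolynomial.X 1) ^ p.2 * MvPolynomial.X 1 ^ p.1) := by
  have hs : (MvPolynomial.X 0 - MvPolynomial.X 1 : MvPolynomial (Fin 2) K) ≠ 0 := by
    intro h
    have := congrArg (MvPolynomial.eval ![1, 0]) h
    simp at this
  have h := inv_factorial_smul_add_pow K (Commute.all (MvPolynomial.X 1)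
    (MvPolynomial.X 0 - MvPolynomial.X 1 : MvPolynomial (Fin 2) K)) (n + 1)
  rw [add_sub_cancel, Finset.Nat.sum_antidiagonal_succ'] at h
  refine mul_left_cancel₀ hs ?_
  rw [mul_smul_comm, mul_sum_antidiagonal_pow (Commute.all _ _), smul_sub, h, Finset.mul_sum]
  simp only [pow_zero, Nat.factorial_zero, Nat.cast_one, inv_one, one_smul, mul_one,
    add_sub_cancel_left]
  refine Finset.sum_congr rfl fun p _ => ?_
  rw [smul_mul_smul_comm, mul_smul_comm, pow_succ]
  congr 1
  ring

/-- The derivative of the exponential for noncommuting arguments: $E(Z^{n+1})=\sum Z^i (EZ) Z^j$,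
and `sum_antidiagonal_pow_eq` at left and right multiplication by $Z$ moves all powers of $Z$ to the
right. -/
theorem euler_exp {Z : MvPowerSeries (Fin 2) A} (hZ : VanishBelow 1 Z) :
    euler (K := K) (elemEval Z (PowerSeries.exp K))
      = opEval (adOp K Z) (expDiv K) (euler (K := K) Z) * elemEval Z (PowerSeries.exp K) := by
  refine MvPowerSeries.ext fun d => ?_
  rw [← opEval_mulRight hZ, coeff_opEval_opEval (isRaising_mulRight K hZ) (isRaising_adOp K hZ),
    coeff_euler, coeff_elemEval]
  have key : ∀ n, ∑ r ∈ antidiagonal n,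
      (PowerSeries.coeff r.1 (PowerSeries.exp K) * PowerSeries.coeff r.2 (expDiv K)) •
        MvPowerSeries.coeff d ((LinearMap.mulRight K Z ^ r.1) ((adOp K Z ^ r.2) (euler (K := K) Z)))
      = ((n + 1).factorial : K)⁻¹ • MvPowerSeries.coeff d (euler (K := K) (Z ^ (n + 1))) := by
    intro n
    have h := congrArg (sandwich Z (euler (K := K) Z)) (sum_antidiagonal_pow_eq (K := K) n)
    have h1 : ∀ i j, sandwich Z (euler (K := K) Z)
        ((MvPolynomial.X 0 - MvPolynomial.X 1) ^ j * MvPolynomial.X 1 ^ i :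
          MvPolynomial (Fin 2) K) = (adOp K Z ^ j) (euler (K := K) Z) * Z ^ i := by
      intro i j
      have h2 := sandwich_sub_pow_mul Z (fun j => (adOp K Z ^ j) (euler (K := K) Z))
        (fun j => by rw [pow_succ', Module.End.mul_apply, adOp_apply]) j
        (MvPolynomial.X 0 ^ 0 * MvPolynomial.X 1 ^ i : MvPolynomial (Fin 2) K)
      rw [sandwich_X_pow] at h2
      simpa using h2
    simp only [map_smul, map_sum, sandwich_X_pow, h1] at h
    rw [← euler_pow_succ] at h
    rw [← coeff_smul', h, map_sum]
    refine Finset.sum_congr rfl fun r _ => ?_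
    rw [coeff_smul', LinearMap.pow_mulRight, LinearMap.mulRight_apply]
    simp [PowerSeries.coeff_exp, expDiv]
  simp only [key]
  -- The two sums are shifted by one against each other. The extra top term vanishes because
  -- $Z^{\deg d+1}$ has no part of degree $d$, and the extra bottom term because $E1=0$.
  have h0 : MvPowerSeries.coeff d (euler (K := K) (Z ^ (Finsupp.degree d + 1))) = 0 := by
    have h := (isRaising_mulLeft K hZ).pow_apply (vanishBelow_zero 1) (Finsupp.degree d + 1) d
      (by omega)
    rw [LinearMap.pow_mulLeft, LinearMap.mulLeft_apply, mul_one] at h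
    rw [coeff_euler, h, smul_zero]
  rw [Finset.sum_range_succ _ (Finsupp.degree d), Finset.sum_range_succ (fun n : ℕ => ((n + 1).factorial : K)⁻¹ •
    MvPowerSeries.coeff d (euler (K := K) (Z ^ (n + 1)))), h0, smul_zero, add_zero,
    ← Finset.sum_range_succ, Finset.smul_sum, Finset.sum_range_succ']
  have h1 : ((Finsupp.degree d : ℕ) : K) • PowerSeries.coeff 0 (PowerSeries.exp K) •
      MvPowerSeries.coeff d (Z ^ 0) = 0 := by
    rw [smul_comm, ← coeff_euler, pow_zero, euler_one, map_zero, smul_zero]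
  rw [h1, add_zero]
  refine Finset.sum_congr rfl fun n _ => ?_
  rw [smul_comm, ← coeff_euler]
  simp [PowerSeries.coeff_exp]

/-- This is $e^{\mathrm{ad}\,u}w=e^u w e^{-u}$: left multiplication by $u$ is the sum of the
commuting operators right multiplication and $\mathrm{ad}\,u$. -/
theorem exp_adOp_mul {u : MvPowerSeries (Fin 2) A} (hu : VanishBelow 1 u)
    (w : MvPowerSeries (Fin 2) A) :
    opEval (adOp K u) (PowerSeries.exp K) w * elemEval u (PowerSeries.exp K)
      = elemEval u (PowerSeries.exp K) * w := by
  have h := opEval_exp_add (isRaising_mulRight K hu) (isRaising_adOp K hu)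
    (((commute_mulLeft_mulRight u u).symm).sub_right (Commute.refl _))
  rw [adOp, add_sub_cancel] at h
  rw [← opEval_mulRight hu, ← opEval_mulLeft hu, h]
  rfl

theorem elemEval_exp_mul_neg {u : MvPowerSeries (Fin 2) A} (hu : VanishBelow 1 u) :
    elemEval u (PowerSeries.exp K) * elemEval (-u) (PowerSeries.exp K) = 1 := by
  have hu' : VanishBelow 1 (-u) := fun d hd => by rw [map_neg, hu d hd, neg_zero]
  have hn : LinearMap.mulLeft K u + LinearMap.mulLeft K (-u) = 0 := by ext1 f; simp
  have hc : Commute (LinearMap.mulLeft K u) (LinearMap.mulLeft K (-u)) :=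
    LinearMap.ext fun f => by simp
  have h := opEval_exp_add (isRaising_mulLeft K hu) (isRaising_mulLeft K hu') hc
  rw [hn, opEval_zero, PowerSeries.constantCoeff_exp, one_smul] at h
  rw [← opEval_mulLeft hu, elemEval, ← Module.End.mul_apply, ← h, Module.End.one_apply]

theorem elemEval_exp_right_cancel {u f h : MvPowerSeries (Fin 2) A} (hu : VanishBelow 1 u)
    (H : f * elemEval u (PowerSeries.exp K) = h * elemEval u (PowerSeries.exp K)) : f = h := by
  rw [← mul_one f, ← mul_one h, ← elemEval_exp_mul_neg (K := K) hu, ← mul_assoc, ← mul_assoc, H]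

/-- Such an $x$ is homogeneous of degree $1$. As $\mathrm{ad}_x$ kills $Ex=x$, only the constant
term of $(e^{\mathrm{ad}\,x}-1)/\mathrm{ad}\,x$ contributes. -/
theorem euler_exp_of_euler_eq {x : MvPowerSeries (Fin 2) A} (hx : euler (K := K) x = x) :
    euler (K := K) (elemEval x (PowerSeries.exp K)) = x * elemEval x (PowerSeries.exp K) := by
  have hx1 : VanishBelow 1 x := hx ▸ vanishBelow_euler x
  rw [euler_exp hx1, hx]
  congr 1
  refine MvPowerSeries.ext fun d => ?_
  rw [coeff_opEval, Finset.sum_eq_single 0]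
  · simp [expDiv]
  · intro i _ hi
    obtain ⟨i, rfl⟩ := Nat.exists_eq_succ_of_ne_zero hi
    rw [pow_succ, Module.End.mul_apply, adOp_apply, sub_self, map_zero, map_zero, smul_zero]
  · simp

/-- The logarithm of `exp x exp y`, and the differential equation which it satisfies. -/
theorem exists_log_exp_mul_exp {x y : MvPowerSeries (Fin 2) A} (hx : euler (K := K) x = x)
    (hy : euler (K := K) y = y) :
    ∃ Z : MvPowerSeries (Fin 2) A, VanishBelow 1 Z ∧
      elemEval Z (PowerSeries.exp K)
        = elemEval x (PowerSeries.exp K) * elemEval y (PowerSeries.exp K) ∧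
      euler (K := K) Z = opEval (opEval (adOp K x) (PowerSeries.exp K) *
          opEval (adOp K y) (PowerSeries.exp K) - 1) (logDiv K)
        (x + opEval (adOp K x) (PowerSeries.exp K) y) := by
  have hx1 : VanishBelow 1 x := hx ▸ vanishBelow_euler x
  have hy1 : VanishBelow 1 y := hy ▸ vanishBelow_euler y
  set Ex := elemEval x (PowerSeries.exp K) with hEx
  set Ey := elemEval y (PowerSeries.exp K) with hEy
  have hexp1 : ∀ u : MvPowerSeries (Fin 2) A, VanishBelow 1 u →
      VanishBelow 1 (elemEval u (PowerSeries.exp K) - 1) := fun u hu => by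
    have := vanishBelow_sub_elemEval hu (PowerSeries.exp K) 1
    simpa using this
  have hU : VanishBelow 1 (Ex * Ey - 1) := by
    have h1 := (hexp1 x hx1).mul (vanishBelow_zero Ey)
    have h2 := hexp1 y hy1
    intro d hd
    have := congrArg₂ (· + ·) (h1 d hd) (h2 d hd)
    simp only [← map_add, add_zero] at this
    rw [← this]
    congr 1
    rw [sub_mul, one_mul, ← hEx, ← hEy]
    abel
  set Z := elemEval (Ex * Ey - 1) (PowerSeries.log K) with hZdef
  have hZ : VanishBelow 1 Z := by
    have := vanishBelow_sub_elemEval hU (PowerSeries.log K) 1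
    simpa using this
  have hZE : elemEval Z (PowerSeries.exp K) = Ex * Ey := by
    have hm : LinearMap.mulLeft K Z = opEval (LinearMap.mulLeft K (Ex * Ey - 1)) (PowerSeries.log K) :=
      LinearMap.ext fun f => (opEval_mulLeft hU _ f).symm
    rw [elemEval, hm, opEval_opEval (isRaising_mulLeft K hU) PowerSeries.constantCoeff_log,
      exp_subst_log, opEval_add, opEval_one, opEval_X (isRaising_mulLeft K hU)]
    simp
  refine ⟨Z, hZ, hZE, ?_⟩
  set v := x + opEval (adOp K x) (PowerSeries.exp K) y with hv
  have hcancel : ∀ f h : MvPowerSeries (Fin 2) A, f * (Ex * Ey) = h * (Ex * Ey) → f = h := by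
    intro f h H
    rw [← hZE] at H
    exact elemEval_exp_right_cancel hZ H
  -- Differentiate $e^Z=e^xe^y$ by $E$, move $y$ past $e^x$ by conjugation, and cancel $e^xe^y$ on
  -- the right.
  have hvE : v = opEval (adOp K Z) (expDiv K) (euler (K := K) Z) := by
    apply hcancel
    rw [← hZE, ← euler_exp hZ, hZE, euler_mul, hEx, hEy, euler_exp_of_euler_eq hx,
      euler_exp_of_euler_eq hy, hv, add_mul, ← mul_assoc (opEval _ _ _), exp_adOp_mul hx1,
      mul_assoc, mul_assoc]
  -- Conjugation by $e^Z$ is conjugation by $e^y$ followed by conjugation by $e^x$.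
  have hP : opEval (adOp K x) (PowerSeries.exp K) * opEval (adOp K y) (PowerSeries.exp K)
      = opEval (adOp K Z) (PowerSeries.exp K) := by
    refine LinearMap.ext fun w => hcancel _ _ ?_
    rw [Module.End.mul_apply, ← hZE, exp_adOp_mul hZ, hZE, ← mul_assoc, hEx, exp_adOp_mul hx1,
      mul_assoc, hEy, exp_adOp_mul hy1, mul_assoc]
  have hP1 : opEval (adOp K Z) (PowerSeries.exp K) - 1
      = opEval (adOp K Z) (PowerSeries.exp K - 1) := by
    have := opEval_add (adOp K Z) (PowerSeries.exp K - 1) 1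
    rw [sub_add_cancel, opEval_one] at this
    rw [this, add_sub_cancel_right]
  -- Now `logDiv` at $e^{\mathrm{ad}\,Z}-1$ inverts `expDiv` at $\mathrm{ad}\,Z$, which solves `hvE`
  -- for $EZ$.
  rw [hP, hP1, opEval_opEval (isRaising_adOp K hZ) (by simp [PowerSeries.constantCoeff_exp]), hvE,
    ← Module.End.mul_apply, ← opEval_mul (isRaising_adOp K hZ), logDiv_subst_mul_expDiv, opEval_one,
    Module.End.one_apply]

end FormalExp

/-! ### Expansion of the differential equation into Dynkin's words -/

section Dynkin

/-- The multi-index with entries `a` and `b`. -/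
def biDeg (a b : ℕ) : Fin 2 →₀ ℕ := Finsupp.single 0 a + Finsupp.single 1 b

theorem degree_biDeg (a b : ℕ) : Finsupp.degree (biDeg a b) = a + b := by simp [biDeg]

theorem eq_biDeg (d : Fin 2 →₀ ℕ) : d = biDeg (d 0) (d 1) := by
  ext i; fin_cases i <;> simp [biDeg]

theorem biDeg_add (a b c d : ℕ) : biDeg a b + biDeg c d = biDeg (a + c) (b + d) := by
  ext i; fin_cases i <;> simp [biDeg]

theorem biDeg_inj {a b c d : ℕ} : biDeg a b = biDeg c d ↔ a = c ∧ b = d := by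
  refine ⟨fun h => ⟨?_, ?_⟩, fun h => by rw [h.1, h.2]⟩
  · simpa [biDeg] using DFunLike.congr_fun h 0
  · simpa [biDeg] using DFunLike.congr_fun h 1

theorem bchWord_cons {A : Type*} (ξ η : A) {m : ℕ} (r s : ℕ) (t u : Fin m → ℕ) :
    bchWord ξ η (Fin.cons r t : Fin (m + 1) → ℕ) (Fin.cons s u : Fin (m + 1) → ℕ)
      = List.replicate r ξ ++ (List.replicate s η ++ bchWord ξ η t u) := by
  simp [bchWord, List.ofFn_succ]

theorem bchWord_ne_nil {A : Type*} (ξ η : A) {m : ℕ} {r s : Fin (m + 1) → ℕ}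
    (h : ∀ i, 1 ≤ r i + s i) :
    bchWord ξ η r s ≠ [] := by
  have h0 := h 0
  intro hn
  simp [bchWord, List.ofFn_succ] at hn
  omega

variable {K : Type*} [Field K] {A : Type*} [Ring A] [Algebra K A]

variable (K) in
/-- The commutator with an element of an algebra. -/
def commOp (ξ : A) : Module.End K A := LinearMap.mulLeft K ξ - LinearMap.mulRight K ξ

theorem coeff_adOp_monomial (e : Fin 2 →₀ ℕ) (ξ : A) (f : MvPowerSeries (Fin 2) A)
    (d : Fin 2 →₀ ℕ) :
    MvPowerSeries.coeff (e + d) (adOp K (MvPowerSeries.monomial e ξ) f)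
      = commOp K ξ (MvPowerSeries.coeff d f) := by
  rw [adOp_apply, map_sub, MvPowerSeries.coeff_add_monomial_mul, add_comm,
    MvPowerSeries.coeff_add_mul_monomial]
  rfl

theorem coeff_adOp_monomial_of_not_le {e d : Fin 2 →₀ ℕ} (h : ¬e ≤ d) (ξ : A)
    (f : MvPowerSeries (Fin 2) A) :
    MvPowerSeries.coeff d (adOp K (MvPowerSeries.monomial e ξ) f) = 0 := by
  classical
  rw [adOp_apply, map_sub, MvPowerSeries.coeff_monomial_mul, MvPowerSeries.coeff_mul_monomial,
    if_neg h, if_neg h, sub_zero]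

theorem coeff_adOp_pow (e : Fin 2 →₀ ℕ) (ξ : A) (f : MvPowerSeries (Fin 2) A)
    (d : Fin 2 →₀ ℕ) (i : ℕ) :
    MvPowerSeries.coeff (i • e + d) ((adOp K (MvPowerSeries.monomial e ξ) ^ i) f)
      = (commOp K ξ ^ i) (MvPowerSeries.coeff d f) := by
  induction i with
  | zero => simp
  | succ i ih =>
    rw [pow_succ', Module.End.mul_apply, succ_nsmul', add_assoc, coeff_adOp_monomial, ih,
      pow_succ', Module.End.mul_apply]

theorem coeff_adOp_pow_of_not_le {e d : Fin 2 →₀ ℕ} {i : ℕ} (h : ¬i • e ≤ d) (ξ : A)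
    (f : MvPowerSeries (Fin 2) A) :
    MvPowerSeries.coeff d ((adOp K (MvPowerSeries.monomial e ξ) ^ i) f) = 0 := by
  induction i generalizing d with
  | zero => simp at h
  | succ i ih =>
    rw [pow_succ', Module.End.mul_apply]
    by_cases hd : e ≤ d
    · obtain ⟨d, rfl⟩ := exists_add_of_le hd
      rw [coeff_adOp_monomial, ih, map_zero]
      rwa [succ_nsmul', add_le_add_iff_left] at h
    · exact coeff_adOp_monomial_of_not_le hd _ _

theorem sum_antidiagonalTuple_succ {M : Type*} [AddCommMonoid M] (m a : ℕ)
    (F : (Fin (m + 1) → ℕ) → M) :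
    ∑ t ∈ Finset.Nat.antidiagonalTuple (m + 1) a, F t
      = ∑ p ∈ antidiagonal a, ∑ t ∈ Finset.Nat.antidiagonalTuple m p.2, F (Fin.cons p.1 t) := by
  rw [Finset.sum_sigma']
  symm
  refine Finset.sum_nbij' (fun x => Fin.cons x.1.1 x.2)
    (fun t => ⟨(t 0, ∑ i, Fin.tail t i), Fin.tail t⟩) ?_ ?_ ?_ ?_ ?_
  · rintro ⟨⟨r, a'⟩, t⟩ h
    simp only [Finset.mem_sigma, Finset.HasAntidiagonal.mem_antidiagonal,
      Finset.Nat.mem_antidiagonalTuple] at h ⊢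
    rw [Fin.sum_univ_succ]
    simp [h.1, h.2]
  · intro t h
    simp only [Finset.mem_sigma, Finset.HasAntidiagonal.mem_antidiagonal,
      Finset.Nat.mem_antidiagonalTuple] at h ⊢
    rw [Fin.sum_univ_succ] at h
    exact ⟨h, trivial⟩
  · rintro ⟨⟨r, a'⟩, t⟩ h
    simp only [Finset.mem_sigma, Finset.Nat.mem_antidiagonalTuple] at h
    obtain ⟨_, rfl⟩ := h
    simp
  · intro t _; simp
  · rintro ⟨⟨r, a'⟩, t⟩ _; rfl

section CharZero

variable [CharZero K]

theorem coeff_exp_adOp_zero (ξ : A) (f : MvPowerSeries (Fin 2) A) (a b : ℕ) :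
    MvPowerSeries.coeff (biDeg a b)
      (opEval (adOp K (MvPowerSeries.monomial (biDeg 1 0) ξ)) (PowerSeries.exp K) f)
      = ∑ p ∈ antidiagonal a, (p.1.factorial : K)⁻¹ •
        (commOp K ξ ^ p.1) (MvPowerSeries.coeff (biDeg p.2 b) f) := by
  rw [coeff_opEval, degree_biDeg, Finset.Nat.sum_antidiagonal_eq_sum_range_succ
    (fun r a' => (r.factorial : K)⁻¹ • (commOp K ξ ^ r) (MvPowerSeries.coeff (biDeg a' b) f))]
  symm
  refine Finset.sum_subset_zero_on_sdiff (fun i hi => by simp at hi ⊢; omega) ?_ ?_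
  · intro i hi
    rw [coeff_adOp_pow_of_not_le, smul_zero]
    intro h
    have := h 0
    simp [biDeg] at this hi
    omega
  · intro i hi
    rw [Finset.mem_range] at hi
    have e : biDeg a b = i • biDeg 1 0 + biDeg (a - i) b := by
      ext j; fin_cases j <;> simp [biDeg]; omega
    rw [e, coeff_adOp_pow, PowerSeries.coeff_exp]
    simp

theorem coeff_exp_adOp_one (η : A) (f : MvPowerSeries (Fin 2) A) (a b : ℕ) :
    MvPowerSeries.coeff (biDeg a b)
      (opEval (adOp K (MvPowerSeries.monomial (biDeg 0 1) η)) (PowerSeries.exp K) f)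
      = ∑ p ∈ antidiagonal b, (p.1.factorial : K)⁻¹ •
        (commOp K η ^ p.1) (MvPowerSeries.coeff (biDeg a p.2) f) := by
  rw [coeff_opEval, degree_biDeg, Finset.Nat.sum_antidiagonal_eq_sum_range_succ
    (fun r b' => (r.factorial : K)⁻¹ • (commOp K η ^ r) (MvPowerSeries.coeff (biDeg a b') f))]
  symm
  refine Finset.sum_subset_zero_on_sdiff (fun i hi => by simp at hi ⊢; omega) ?_ ?_
  · intro i hi
    rw [coeff_adOp_pow_of_not_le, smul_zero]
    intro h
    have := h 1
    simp [biDeg] at this hi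
    omega
  · intro i hi
    rw [Finset.mem_range] at hi
    have e : biDeg a b = i • biDeg 0 1 + biDeg a (b - i) := by
      ext j; fin_cases j <;> simp [biDeg]; omega
    rw [e, coeff_adOp_pow, PowerSeries.coeff_exp]
    simp

/-- Subtracting the identity removes the term with exponents $(0,0)$; this is the origin of the
condition $r_i+s_i\ge 1$ in Dynkin's formula. -/
theorem coeff_exp_mul_exp_sub_one (ξ η : A) (f : MvPowerSeries (Fin 2) A) (a b : ℕ) :
    MvPowerSeries.coeff (biDeg a b)
      ((opEval (adOp K (MvPowerSeries.monomial (biDeg 1 0) ξ)) (PowerSeries.exp K) *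
        opEval (adOp K (MvPowerSeries.monomial (biDeg 0 1) η)) (PowerSeries.exp K) - 1) f)
      = ∑ p ∈ antidiagonal a, ∑ q ∈ antidiagonal b, if 1 ≤ p.1 + q.1 then
        ((p.1.factorial : K)⁻¹ * (q.1.factorial : K)⁻¹) •
        (commOp K ξ ^ p.1) ((commOp K η ^ q.1) (MvPowerSeries.coeff (biDeg p.2 q.2) f)) else 0 := by
  have h : ∀ p ∈ antidiagonal a, ∀ q ∈ antidiagonal b, (if 1 ≤ p.1 + q.1 then
        ((p.1.factorial : K)⁻¹ * (q.1.factorial : K)⁻¹) •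
        (commOp K ξ ^ p.1) ((commOp K η ^ q.1) (MvPowerSeries.coeff (biDeg p.2 q.2) f)) else 0)
      = ((p.1.factorial : K)⁻¹ * (q.1.factorial : K)⁻¹) •
        (commOp K ξ ^ p.1) ((commOp K η ^ q.1) (MvPowerSeries.coeff (biDeg p.2 q.2) f))
        - if p = (0, a) then if q = (0, b) then MvPowerSeries.coeff (biDeg a b) f else 0 else 0 := by
    rintro ⟨r, a'⟩ hp ⟨s, b'⟩ hq
    rw [Finset.HasAntidiagonal.mem_antidiagonal] at hp hq
    simp only [Prod.mk.injEq] at hp hq ⊢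
    by_cases hr : r = 0
    · by_cases hs : s = 0
      · subst hr hs
        have ha : a' = a := by omega
        have hb : b' = b := by omega
        subst ha hb
        simp
      · simp [hs, Nat.one_le_iff_ne_zero]
    · simp [hr, Nat.one_le_iff_ne_zero]
  rw [Finset.sum_congr rfl fun p hp => Finset.sum_congr rfl (h p hp)]
  simp only [Finset.sum_sub_distrib]
  rw [LinearMap.sub_apply, map_sub, Module.End.mul_apply, coeff_exp_adOp_zero]
  simp only [coeff_exp_adOp_one, map_sum, map_smul, Finset.smul_sum, smul_smul]
  congr 1
  rw [Finset.sum_eq_single (0, a), Finset.sum_eq_single (0, b)]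
  · simp
  · intro q _ hq; simp [hq]
  · intro hq; simp at hq
  · intro p _ hp; simp [hp]
  · intro hp; simp at hp

end CharZero

variable (K) in
/-- The part of degree `(a, b)` of the sum of the terms with `m` factors in Dynkin's formula. -/
def dynkinSum (ξ η : A) (m a b : ℕ) : A :=
  ∑ r ∈ Finset.Nat.antidiagonalTuple m a, ∑ s ∈ Finset.Nat.antidiagonalTuple m b,
    if ∀ i, 1 ≤ r i + s i then
      (∏ i, (((r i).factorial : K)⁻¹ * ((s i).factorial : K)⁻¹)) • nestedBracket (bchWord ξ η r s)
    else 0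

theorem nestedBracket_cons (ξ : A) {l : List A} (hl : l ≠ []) :
    nestedBracket (ξ :: l) = commOp K ξ (nestedBracket l) := by
  cases l with
  | nil => exact absurd rfl hl
  | cons y l => rw [nestedBracket, LieRing.of_associative_ring_bracket]; rfl

theorem nestedBracket_replicate_append (ξ : A) {l : List A} (hl : l ≠ []) (n : ℕ) :
    nestedBracket (List.replicate n ξ ++ l) = (commOp K ξ ^ n) (nestedBracket l) := by
  induction n with
  | zero => simp
  | succ n ih =>
    rw [List.replicate_succ, List.cons_append, nestedBracket_cons (K := K) ξ (by simp [hl]), ih,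
      pow_succ', Module.End.mul_apply]

theorem nestedBracket_replicate (ξ : A) (n : ℕ) :
    nestedBracket (List.replicate n ξ) = if n = 1 then ξ else 0 := by
  match n with
  | 0 => simp [nestedBracket]
  | 1 => simp [nestedBracket]
  | n + 2 =>
    rw [if_neg (by omega)]
    induction n with
    | zero => simp [nestedBracket]
    | succ n ih =>
      rw [List.replicate_succ] at ih ⊢
      rw [List.replicate_succ, nestedBracket, ih, lie_zero]

/-- Splits off the first block of the word. At least one further block must remain: its word is then
nonempty, and prepending a letter is a commutator. -/
theorem dynkinSum_succ (ξ η : A) (m a b : ℕ) :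
    dynkinSum K ξ η (m + 2) a b = ∑ p ∈ antidiagonal a, ∑ q ∈ antidiagonal b,
      if 1 ≤ p.1 + q.1 then ((p.1.factorial : K)⁻¹ * (q.1.factorial : K)⁻¹) •
        (commOp K ξ ^ p.1) ((commOp K η ^ q.1) (dynkinSum K ξ η (m + 1) p.2 q.2)) else 0 := by
  rw [dynkinSum, sum_antidiagonalTuple_succ]
  refine Finset.sum_congr rfl fun p _ => ?_
  simp only [sum_antidiagonalTuple_succ _ b]
  rw [Finset.sum_comm]
  refine Finset.sum_congr rfl fun q _ => ?_
  split_ifs with hpq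
  · simp only [dynkinSum, map_sum, Finset.smul_sum]
    refine Finset.sum_congr rfl fun t _ => Finset.sum_congr rfl fun u _ => ?_
    simp only [Fin.forall_fin_succ, Fin.cons_zero, Fin.cons_succ, hpq, true_and]
    split_ifs with h
    · have hw := bchWord_ne_nil ξ η (r := t) (s := u) (Fin.forall_fin_succ.2 h)
      rw [bchWord_cons, nestedBracket_replicate_append (K := K) ξ (by simp [hw]),
        nestedBracket_replicate_append (K := K) η hw, Fin.prod_univ_succ]
      simp only [Fin.cons_zero, Fin.cons_succ, map_smul, smul_smul]
    · simp
  · refine Finset.sum_eq_zero fun t _ => Finset.sum_eq_zero fun u _ => ?_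
    rw [if_neg]
    intro h
    exact hpq (by simpa using h 0)

theorem dynkinSum_one (ξ η : A) (a b : ℕ) :
    dynkinSum K ξ η 1 a b = ((a.factorial : K)⁻¹ * (b.factorial : K)⁻¹) •
      nestedBracket (List.replicate a ξ ++ List.replicate b η) := by
  simp only [dynkinSum, Finset.Nat.antidiagonalTuple_one, Finset.sum_singleton]
  -- With no letters the condition on blocks excludes the only term, in agreement with the value $0$
  -- of the empty bracket.
  by_cases h : a = 0 ∧ b = 0
  · simp [h.1, h.2, nestedBracket]
  · rw [if_pos (by intro i; fin_cases i; simp; omega)]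
    simp [bchWord]

theorem dynkinSum_eq_zero (ξ η : A) {m a b : ℕ} (h : a + b < m) : dynkinSum K ξ η m a b = 0 := by
  refine Finset.sum_eq_zero fun r hr => Finset.sum_eq_zero fun s hs => ?_
  rw [Finset.Nat.mem_antidiagonalTuple] at hr hs
  rw [if_neg]
  intro hi
  have := Finset.sum_le_sum fun i (_ : i ∈ Finset.univ) => hi i
  rw [Finset.sum_add_distrib, hr, hs] at this
  simp at this
  omega

variable [CharZero K]

/-- The factor $a+b$, which is the Euler derivation, cancels Dynkin's denominator. The range has one
term more than `bch`, to match `opEval`; it vanishes because $a+b$ letters cannot fill $a+b+1$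
nonempty blocks. -/
theorem bch_eq_sum_dynkinSum (ξ η : A) (a b : ℕ) :
    ((a + b : ℕ) : K) • bch K a b ξ η
      = ∑ i ∈ Finset.range (a + b + 1), ((-1 : K) ^ i / (i + 1)) • dynkinSum K ξ η (i + 1) a b := by
  have h : ∀ i ∈ Finset.range (a + b), ((a + b : ℕ) : K) •
      ∑ p ∈ (Finset.Nat.antidiagonalTuple (i + 1) a ×ˢ Finset.Nat.antidiagonalTuple (i + 1) b).filter
        (fun p => ∀ i, 1 ≤ p.1 i + p.2 i),
      ((-1 : K) ^ (i + 1 - 1) / (((i + 1 : ℕ) : K) * (a + b) *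
        ((∏ i, ((p.1 i).factorial * (p.2 i).factorial) : ℕ) : K))) •
        nestedBracket (bchWord ξ η p.1 p.2)
      = ((-1 : K) ^ i / (i + 1)) • dynkinSum K ξ η (i + 1) a b := by
    intro i hi
    have hab : ((a : K) + b) ≠ 0 := by
      rw [Finset.mem_range] at hi
      exact_mod_cast (by omega : a + b ≠ 0)
    rw [Finset.sum_filter, Finset.sum_product, dynkinSum, Finset.smul_sum, Finset.smul_sum]
    refine Finset.sum_congr rfl fun r _ => ?_
    rw [Finset.smul_sum, Finset.smul_sum]
    refine Finset.sum_congr rfl fun s _ => ?_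
    split_ifs
    · rw [smul_smul, smul_smul]
      congr 1
      push_cast
      simp only [Finset.prod_mul_distrib, Finset.prod_inv_distrib]
      have h1 : ∏ j, ((r j).factorial : K) ≠ 0 :=
        Finset.prod_ne_zero_iff.2 fun j _ => Nat.cast_ne_zero.2 (r j).factorial_ne_zero
      have h2 : ∏ j, ((s j).factorial : K) ≠ 0 :=
        Finset.prod_ne_zero_iff.2 fun j _ => Nat.cast_ne_zero.2 (s j).factorial_ne_zero
      have h3 : (i : K) + 1 ≠ 0 := Nat.cast_add_one_ne_zero i
      field_simp
    · simp
  rw [Finset.sum_range_succ, dynkinSum_eq_zero ξ η (Nat.lt_succ_self _), smul_zero, add_zero, bch,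
    show Finset.Icc 1 (a + b) = Finset.Ico 1 (a + b + 1) from rfl, Finset.sum_Ico_eq_sum_range,
    Nat.add_sub_cancel, Finset.smul_sum]
  refine Finset.sum_congr rfl fun i hi => ?_
  rw [← h i hi]
  have e := add_comm 1 i
  generalize 1 + i = m at e
  subst e
  rfl

/-- Each factor $e^{\mathrm{ad}\,x}e^{\mathrm{ad}\,y}-1$ prepends a nonempty block. The starting
vector $x+e^{\mathrm{ad}\,x}y$ collects the words of one block, since $\xi^a\eta^b$ has zero nested
bracket unless $b=1$, or $b=0$ and $a=1$. -/
theorem coeff_pow_dynkin (ξ η : A) (m a b : ℕ) :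
    MvPowerSeries.coeff (biDeg a b)
      (((opEval (adOp K (MvPowerSeries.monomial (biDeg 1 0) ξ)) (PowerSeries.exp K) *
        opEval (adOp K (MvPowerSeries.monomial (biDeg 0 1) η)) (PowerSeries.exp K) - 1) ^ m)
        (MvPowerSeries.monomial (biDeg 1 0) ξ +
          opEval (adOp K (MvPowerSeries.monomial (biDeg 1 0) ξ)) (PowerSeries.exp K)
            (MvPowerSeries.monomial (biDeg 0 1) η)))
      = dynkinSum K ξ η (m + 1) a b := by
  induction m generalizing a b with
  | succ m ih =>
    rw [pow_succ', Module.End.mul_apply, coeff_exp_mul_exp_sub_one, dynkinSum_succ]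
    simp only [ih]
  | zero =>
    classical
    rw [pow_zero, Module.End.one_apply, map_add, coeff_exp_adOp_zero, dynkinSum_one]
    simp only [MvPowerSeries.coeff_monomial, biDeg_inj]
    cases b with
    | zero =>
      simp only [List.replicate_zero, List.append_nil, nestedBracket_replicate]
      by_cases ha : a = 1 <;> simp [ha]
    | succ b =>
      rw [nestedBracket_replicate_append (K := K) ξ (by simp), nestedBracket_replicate,
        Finset.sum_eq_single (a, 0)]
      · by_cases hb : b = 0 <;> simp [hb]
      · rintro ⟨r, a'⟩ hp hne
        rw [Finset.HasAntidiagonal.mem_antidiagonal] at hp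
        have : a' ≠ 0 := by
          rintro rfl
          exact hne (by simpa using hp)
        simp [this]
      · simp

end Dynkin

/-! ### Symmetrization of powers of vector-valued series -/

section Powers

theorem coeff_pow_eq_sum {A : Type*} [Ring A] (f : MvPowerSeries (Fin 2) A) (n : ℕ)
    (d : Fin 2 →₀ ℕ) :
    MvPowerSeries.coeff d (f ^ n) = ∑ l ∈ Finset.finAntidiagonal n d,
      (List.ofFn fun i => MvPowerSeries.coeff (l i) f).prod := by
  classical
  induction n generalizing d with
  | zero =>
    rw [pow_zero, MvPowerSeries.coeff_one]
    split_ifs with h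
    · rw [Finset.sum_eq_single (fun _ => 0)]
      · simp
      · intro l _ hl; exact absurd (Subsingleton.elim _ _) hl
      · intro hl; simp [h] at hl
    · rw [Finset.sum_eq_zero]
      intro l hl
      rw [Finset.mem_finAntidiagonal] at hl
      exact absurd (by simpa using hl.symm) h
  | succ n ih =>
    rw [pow_succ', MvPowerSeries.coeff_mul]
    simp only [ih, Finset.mul_sum]
    rw [Finset.sum_sigma']
    refine Finset.sum_nbij' (fun x => Fin.cons x.1.1 x.2)
      (fun t => ⟨(t 0, ∑ i, Fin.tail t i), Fin.tail t⟩) ?_ ?_ ?_ ?_ ?_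
    · rintro ⟨⟨r, a'⟩, t⟩ h
      simp only [Finset.mem_sigma, Finset.HasAntidiagonal.mem_antidiagonal,
        Finset.mem_finAntidiagonal] at h ⊢
      rw [Fin.sum_univ_succ]
      simp [h.1, h.2]
    · intro t h
      simp only [Finset.mem_sigma, Finset.HasAntidiagonal.mem_antidiagonal,
        Finset.mem_finAntidiagonal] at h ⊢
      rw [Fin.sum_univ_succ] at h
      exact ⟨h, trivial⟩
    · rintro ⟨⟨r, a'⟩, t⟩ h
      simp only [Finset.mem_sigma, Finset.mem_finAntidiagonal] at h
      obtain ⟨_, rfl⟩ := h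
      simp
    · intro t _; simp
    · rintro ⟨⟨r, a'⟩, t⟩ _
      simp [List.ofFn_succ]

variable {K : Type*} [Field K] [CharZero K] {V : Type*} [AddCommGroup V] [Module K V]
  {A : Type*} [Ring A] [Algebra K A]

/-- Symmetrization is compatible with powers of power series with coefficients in `V`. -/
theorem symmetrization_coeff_pow (φ : V →ₗ[K] A) {v : (Fin 2 →₀ ℕ) → V}
    {f : MvPowerSeries (Fin 2) (SymmetricAlgebra K V)} {h : MvPowerSeries (Fin 2) A}
    (hf : ∀ e, MvPowerSeries.coeff e f = SymmetricAlgebra.ι K V (v e))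
    (hh : ∀ e, MvPowerSeries.coeff e h = φ (v e)) (n : ℕ) (d : Fin 2 →₀ ℕ) :
    symmetrization φ (MvPowerSeries.coeff d (f ^ n)) = MvPowerSeries.coeff d (h ^ n) := by
  rw [coeff_pow_eq_sum, coeff_pow_eq_sum, map_sum]
  simp only [hf, hh, List.prod_ofFn, symmetrization_prod]
  rw [← Finset.smul_sum, Finset.sum_comm]
  -- The set of degree tuples with sum $d$ is invariant under permutations, so the sum over it is
  -- already symmetric and averaging does not change it.
  have h : ∀ σ : Equiv.Perm (Fin n), ∑ l ∈ Finset.finAntidiagonal n d,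
        (List.ofFn fun i => φ (v (l (σ i)))).prod
      = ∑ l ∈ Finset.finAntidiagonal n d, (List.ofFn fun i => φ (v (l i))).prod := by
    intro σ
    refine Finset.sum_nbij' (fun l => l ∘ σ) (fun l => l ∘ σ.symm) ?_ ?_ ?_ ?_ ?_
    · intro l hl
      rw [Finset.mem_finAntidiagonal] at hl ⊢
      rw [← hl]
      exact Equiv.sum_comp σ l
    · intro l hl
      rw [Finset.mem_finAntidiagonal] at hl ⊢
      rw [← hl]
      exact Equiv.sum_comp σ.symm l
    · intro l _; funext i; simp
    · intro l _; funext i; simp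
    · intro l _; rfl
  rw [Finset.sum_congr rfl fun σ _ => h σ, Finset.sum_const, Finset.card_univ, Fintype.card_perm,
    Fintype.card_fin, ← Nat.cast_smul_eq_nsmul K, smul_smul,
    inv_mul_cancel₀ (Nat.cast_ne_zero.2 n.factorial_ne_zero), one_smul]

end Powers

/-! ### The Baker-Campbell-Hausdorff formula in an associative algebra -/

section AssociativeBCH

variable {K : Type*} [Field K] {A : Type*} [Ring A] [Algebra K A]

theorem coeff_elemEval_monomial (e d : Fin 2 →₀ ℕ) (ξ : A) (p : PowerSeries K) :
    MvPowerSeries.coeff d (elemEval (MvPowerSeries.monomial e ξ) p)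
      = ∑ i ∈ Finset.range (Finsupp.degree d + 1),
        if d = i • e then PowerSeries.coeff i p • ξ ^ i else 0 := by
  classical
  rw [coeff_elemEval]
  refine Finset.sum_congr rfl fun i hi => ?_
  clear hi
  have h : (MvPowerSeries.monomial e ξ) ^ i = MvPowerSeries.monomial (i • e) (ξ ^ i) := by
    induction i with
    | zero => simp
    | succ i ih => rw [pow_succ, ih, MvPowerSeries.monomial_mul_monomial, succ_nsmul, pow_succ]
  rw [h, MvPowerSeries.coeff_monomial]
  split_ifs <;> simp

theorem coeff_elemEval_monomial_zero (ξ : A) (p : PowerSeries K) (a b : ℕ) :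
    MvPowerSeries.coeff (biDeg a b) (elemEval (MvPowerSeries.monomial (biDeg 1 0) ξ) p)
      = if b = 0 then PowerSeries.coeff a p • ξ ^ a else 0 := by
  have h : ∀ i : ℕ, i • biDeg 1 0 = biDeg i 0 := fun i => by simp [biDeg]
  simp only [coeff_elemEval_monomial, h, biDeg_inj, degree_biDeg]
  split_ifs with hb
  · simp [hb]
  · simp [hb]

theorem coeff_elemEval_monomial_one (η : A) (p : PowerSeries K) (a b : ℕ) :
    MvPowerSeries.coeff (biDeg a b) (elemEval (MvPowerSeries.monomial (biDeg 0 1) η) p)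
      = if a = 0 then PowerSeries.coeff b p • η ^ b else 0 := by
  have h : ∀ i : ℕ, i • biDeg 0 1 = biDeg 0 i := fun i => by simp [biDeg]
  simp only [coeff_elemEval_monomial, h, biDeg_inj, degree_biDeg]
  split_ifs with ha
  · simp [ha]
  · simp [ha]

/-- One series involves only the first variable and the other only the second, so a single term of
the convolution survives. It is used for the product of $A$ and for a candidate star product. -/
theorem sum_bilin_elemEval_monomial {M : Type*} [AddCommGroup M] [Module K M]
    (D : A →ₗ[K] A →ₗ[K] M) (ξ η : A) (p q : PowerSeries K) (a b : ℕ) :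
    ∑ r ∈ antidiagonal (biDeg a b),
      D (MvPowerSeries.coeff r.1 (elemEval (MvPowerSeries.monomial (biDeg 1 0) ξ) p))
        (MvPowerSeries.coeff r.2 (elemEval (MvPowerSeries.monomial (biDeg 0 1) η) q))
      = D (PowerSeries.coeff a p • ξ ^ a) (PowerSeries.coeff b q • η ^ b) := by
  rw [Finset.sum_eq_single (biDeg a 0, biDeg 0 b)]
  · simp [coeff_elemEval_monomial_zero, coeff_elemEval_monomial_one]
  · rintro ⟨r, s⟩ h hne
    rw [Finset.HasAntidiagonal.mem_antidiagonal] at h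
    simp only at h ⊢
    rw [eq_biDeg r, eq_biDeg s, biDeg_add, biDeg_inj] at h
    rw [eq_biDeg r, eq_biDeg s, coeff_elemEval_monomial_zero, coeff_elemEval_monomial_one]
    by_cases h1 : r 1 = 0
    · by_cases h2 : s 0 = 0
      · refine absurd ?_ hne
        rw [Prod.mk.injEq, eq_biDeg r, eq_biDeg s, biDeg_inj, biDeg_inj]
        omega
      · simp [h2]
    · simp [h1]
  · intro h
    simp [biDeg_add] at h

theorem euler_monomial {e : Fin 2 →₀ ℕ} (he : Finsupp.degree e = 1) (ξ : A) :
    euler (K := K) (MvPowerSeries.monomial e ξ) = MvPowerSeries.monomial e ξ := by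
  classical
  refine MvPowerSeries.ext fun d => ?_
  rw [coeff_euler, MvPowerSeries.coeff_monomial]
  split_ifs with h
  · rw [h, he, Nat.cast_one, one_smul]
  · rw [smul_zero]

variable [CharZero K]

theorem bch_zero_zero {g : Type*} [LieRing g] [LieAlgebra K g] (ξ η : g) : bch K 0 0 ξ η = 0 := by
  simp [bch]

variable (K) in
/-- The Baker-Campbell-Hausdorff series of two elements of an associative algebra. -/
def algBch (ξ η : A) : MvPowerSeries (Fin 2) A := fun d => bch K (d 0) (d 1) ξ η

/-- The Baker-Campbell-Hausdorff formula in an associative algebra. -/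
theorem elemEval_bch (ξ η : A) :
    elemEval (algBch K ξ η) (PowerSeries.exp K)
      = elemEval (MvPowerSeries.monomial (biDeg 1 0) ξ) (PowerSeries.exp K) *
        elemEval (MvPowerSeries.monomial (biDeg 0 1) η) (PowerSeries.exp K) := by
  obtain ⟨Z, hZ, hE, hD⟩ := exists_log_exp_mul_exp (K := K)
    (euler_monomial (e := biDeg 1 0) (by rw [degree_biDeg]) ξ)
    (euler_monomial (e := biDeg 0 1) (by rw [degree_biDeg]) η)
  rw [← hE]
  congr 1
  refine MvPowerSeries.ext fun d => ?_
  change bch K (d 0) (d 1) ξ η = _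
  have h := congrArg (MvPowerSeries.coeff d) hD
  rw [eq_biDeg d, coeff_euler, coeff_opEval, degree_biDeg] at h
  simp only [coeff_pow_dynkin, logDiv, PowerSeries.coeff_mk] at h
  rw [← bch_eq_sum_dynkinSum, ← eq_biDeg] at h
  -- The equation determines the coefficients of $Z$ only up to the factor $a+b$; in degree $0$ both
  -- series vanish.
  by_cases h0 : d 0 + d 1 = 0
  · rw [hZ d (by rw [eq_biDeg d, degree_biDeg]; omega), show d 0 = 0 by omega,
      show d 1 = 0 by omega, bch_zero_zero]
  · exact (smul_right_injective A (Nat.cast_ne_zero.2 h0) h).symm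

theorem coeff_elemEval_bch (ξ η : A) (a b : ℕ) :
    MvPowerSeries.coeff (biDeg a b)
      (elemEval (algBch K ξ η) (PowerSeries.exp K))
      = ((a.factorial : K)⁻¹ • ξ ^ a) * ((b.factorial : K)⁻¹ • η ^ b) := by
  have h := sum_bilin_elemEval_monomial (LinearMap.mul K A) ξ η (PowerSeries.exp K)
    (PowerSeries.exp K) a b
  rw [elemEval_bch, MvPowerSeries.coeff_mul]
  simpa [PowerSeries.coeff_exp] using h

end AssociativeBCH

/-! ### Brackets and BCH under morphisms and rescaling -/

section Naturality

variable {K : Type*} [Field K] {g : Type*} [LieRing g] [LieAlgebra K g]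

theorem map_nestedBracket {h : Type*} [LieRing h] [LieAlgebra K h] (φ : g →ₗ⁅K⁆ h) (l : List g) :
    φ (nestedBracket l) = nestedBracket (l.map φ) := by
  induction l with
  | nil => simp [nestedBracket]
  | cons x l ih =>
    cases l with
    | nil => simp [nestedBracket]
    | cons y l => simpa [nestedBracket] using congrArg (fun w => ⁅φ x, w⁆) ih

theorem map_bchWord {L M : Type*} (φ : L → M) (ξ η : L) {m : ℕ} (r s : Fin m → ℕ) :
    (bchWord ξ η r s).map φ = bchWord (φ ξ) (φ η) r s := by
  simp [bchWord, List.map_flatten, List.map_ofFn, Function.comp_def]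

theorem length_bchWord {L : Type*} (ξ η : L) {m : ℕ} (r s : Fin m → ℕ) :
    (bchWord ξ η r s).length = ∑ i, r i + ∑ i, s i := by
  simp [bchWord, List.length_flatten, List.map_ofFn, Function.comp_def, List.sum_ofFn,
    Finset.sum_add_distrib]

variable (K) in
theorem map_bch {h : Type*} [LieRing h] [LieAlgebra K h] (φ : g →ₗ⁅K⁆ h) (a b : ℕ) (ξ η : g) :
    φ (bch K a b ξ η) = bch K a b (φ ξ) (φ η) := by
  simp only [bch, map_sum, map_smul, map_nestedBracket, map_bchWord]

/-- A nonempty word of $n$ letters has $n-1$ brackets, each contributing one $z$. This accounts for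
the exponent $a+b-1$ in $\frac1z\mathrm{BCH}(z\xi,z\eta)$, also for $z=0$. -/
theorem nestedBracket_map_toRescaled (z : K) (l : List g) :
    nestedBracket (l.map (toRescaled K z)) = toRescaled K z (z ^ (l.length - 1) • nestedBracket l) := by
  induction l with
  | nil => simp [nestedBracket]
  | cons x l ih =>
    cases l with
    | nil => simp [nestedBracket]
    | cons y l =>
      simp only [List.map_cons, nestedBracket, List.length_cons, Nat.add_sub_cancel] at ih ⊢
      rw [ih, rescaled_bracket, lie_smul, smul_smul, ← pow_succ']

theorem toRescaled_bch (z : K) (a b : ℕ) (ξ η : g) :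
    toRescaled K z (z ^ (a + b - 1) • bch K a b ξ η)
      = bch K a b (toRescaled K z ξ) (toRescaled K z η) := by
  simp only [bch, Finset.smul_sum, map_sum]
  refine Finset.sum_congr rfl fun m _ => Finset.sum_congr rfl fun p hp => ?_
  simp only [Finset.mem_filter, Finset.mem_product, Finset.Nat.mem_antidiagonalTuple] at hp
  rw [← map_bchWord, nestedBracket_map_toRescaled, length_bchWord, hp.1.1, hp.1.2, smul_comm,
    map_smul]

end Naturality

/-! ### Drinfel'd's product -/

section DrinfeldStar

variable (K : Type*) [Field K] {g : Type*} [LieRing g] [LieAlgebra K g]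

theorem C_mul_X_eq_monomial (ξ : SymmetricAlgebra K g) (i : Fin 2) :
    (MvPowerSeries.C ξ * MvPowerSeries.X i : FormalSym K g)
      = MvPowerSeries.monomial (Finsupp.single i 1) ξ := by
  classical
  refine MvPowerSeries.ext fun d => ?_
  rw [MvPowerSeries.coeff_C_mul, MvPowerSeries.coeff_X, MvPowerSeries.coeff_monomial]
  simp

variable [CharZero K]

theorem formalExp_eq_elemEval {f : FormalSym K g} (hf : MvPowerSeries.constantCoeff f = 0) :
    formalExp K f = elemEval f (PowerSeries.exp K) := by
  have hs : PowerSeries.HasSubst f := PowerSeries.HasSubst.of_constantCoeff_zero hf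
  have h1 : VanishBelow 1 f := by
    intro d hd
    rw [(Finsupp.degree_eq_zero_iff d).1 (by omega)]
    exact hf
  refine MvPowerSeries.ext fun d => ?_
  rw [formalExp, PowerSeries.coeff_subst hs, coeff_elemEval, finsum_eq_sum_of_support_subset]
  intro i hi
  by_contra h
  have := (isRaising_mulLeft K h1).pow_apply (vanishBelow_zero 1) i d (by simp at h; omega)
  rw [LinearMap.pow_mulLeft, LinearMap.mulLeft_apply, mul_one] at this
  exact hi (by simp [this])

theorem coeff_formalMul_exp
    (D : SymmetricAlgebra K g →ₗ[K] SymmetricAlgebra K g →ₗ[K] SymmetricAlgebra K g) (ξ η : g)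
    (a b : ℕ) :
    MvPowerSeries.coeff (biDeg a b) (formalMul K D
        (formalExp K (MvPowerSeries.C (SymmetricAlgebra.ι K g ξ) * MvPowerSeries.X 0))
        (formalExp K (MvPowerSeries.C (SymmetricAlgebra.ι K g η) * MvPowerSeries.X 1)))
      = D (divPow K a ξ) (divPow K b η) := by
  rw [formalExp_eq_elemEval K (by simp), formalExp_eq_elemEval K (by simp), C_mul_X_eq_monomial,
    C_mul_X_eq_monomial, show Finsupp.single 0 1 = biDeg 1 0 by simp [biDeg],
    show Finsupp.single 1 1 = biDeg 0 1 by simp [biDeg]]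
  refine (sum_bilin_elemEval_monomial D _ _ _ _ a b).trans ?_
  simp [PowerSeries.coeff_exp, divPow]

/-- The coefficients of the series lie in $\mathfrak g$, so $\mathfrak q_z$ maps its powers, hence
its exponential, to those of its image in $U(\mathfrak g_z)$. By naturality that image is the BCH
series of two elements of $U(\mathfrak g_z)$, whose exponential is the product of their
exponentials. -/
theorem quantRescaled_coeff_exp_bchSeries (z : K) (ξ η : g) (a b : ℕ) :
    quantRescaled K g z (MvPowerSeries.coeff (biDeg a b) (formalExp K (bchSeries K z ξ η)))
      = quantRescaled K g z (divPow K a ξ) * quantRescaled K g z (divPow K b η) := by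
  let j : Rescaled z g →ₗ⁅K⁆ UniversalEnvelopingAlgebra K (Rescaled z g) :=
    UniversalEnvelopingAlgebra.ι K
  have hser : ∀ d, MvPowerSeries.coeff d (bchSeries K z ξ η)
      = SymmetricAlgebra.ι K g (z ^ (d 0 + d 1 - 1) • bch K (d 0) (d 1) ξ η) := fun d => by
    rw [map_smul]
    rfl
  have himg : ∀ d, MvPowerSeries.coeff d (algBch K (j (toRescaled K z ξ)) (j (toRescaled K z η)))
      = (j.toLinearMap ∘ₗ (toRescaled K z).toLinearMap)
        (z ^ (d 0 + d 1 - 1) • bch K (d 0) (d 1) ξ η) := fun d => by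
    change bch K (d 0) (d 1) (j (toRescaled K z ξ)) (j (toRescaled K z η)) = _
    rw [← map_bch, ← toRescaled_bch]
    rfl
  have h0 : MvPowerSeries.constantCoeff (bchSeries K z ξ η) = 0 := by
    change z ^ _ • SymmetricAlgebra.ι K g (bch K 0 0 ξ η) = 0
    simp [bch]
  rw [formalExp_eq_elemEval K h0, coeff_elemEval, show quantRescaled K g z
    = symmetrization (j.toLinearMap ∘ₗ (toRescaled K z).toLinearMap) from rfl]
  simp only [map_sum, map_smul, symmetrization_coeff_pow _ hser himg]
  rw [← coeff_elemEval, coeff_elemEval_bch]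
  simp only [divPow, map_smul, symmetrization_pow]
  rfl

/-- The part of degree $(a,b)$ of the defining equation prescribes $D$ on $\xi^a/a!$ and
$\eta^b/b!$. These span, which gives uniqueness, and injectivity of $\mathfrak q_z$ identifies the
prescribed value with that of the pulled-back product. -/
theorem isDrinfeldStar_iff (z : K)
    (D : SymmetricAlgebra K g →ₗ[K] SymmetricAlgebra K g →ₗ[K] SymmetricAlgebra K g) :
    IsDrinfeldStar K z D ↔ D = guttStar K z := by
  have key : IsDrinfeldStar K z D ↔ ∀ (ξ η : g) (a b : ℕ),
      D (divPow K a ξ) (divPow K b η) = pbwStar K z (divPow K a ξ) (divPow K b η) := by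
    refine forall_congr' fun ξ => forall_congr' fun η => ?_
    have h : ∀ a b, MvPowerSeries.coeff (biDeg a b) (formalExp K (bchSeries K z ξ η))
        = pbwStar K z (divPow K a ξ) (divPow K b η) := fun a b =>
      (quantRescaled_bijective K z).1 ((quantRescaled_coeff_exp_bchSeries K z ξ η a b).trans
        (map_pullbackMul (quantRescaled_bijective K z) _ _).symm)
    refine ⟨fun H a b => ?_, fun H => MvPowerSeries.ext fun d => ?_⟩
    · rw [← h, ← H, coeff_formalMul_exp]
    · rw [eq_biDeg d, h, coeff_formalMul_exp, H]
  rw [key, guttStar_eq_pbwStar]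
  refine ⟨fun H => ?_, fun H => by rw [H]; exact fun _ _ _ _ => rfl⟩
  exact linearMap_ext_divPow fun ξ a => linearMap_ext_divPow fun η b => H ξ η a b

end DrinfeldStar

end

end GuttStar

theorem mainTheorem3 {K : Type*} [Field K] [CharZero K]
    {g : Type*} [LieRing g] [LieAlgebra K g] (z : K) :
    Function.Bijective (GuttStar.quant K g) ∧
    Function.Bijective (GuttStar.quantRescaled K g z) ∧
    (∀ x y : SymmetricAlgebra K g, GuttStar.guttStar K z x y = GuttStar.pbwStar K z x y) ∧
    (∀ D : SymmetricAlgebra K g →ₗ[K] SymmetricAlgebra K g →ₗ[K] SymmetricAlgebra K g,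
      GuttStar.IsDrinfeldStar K z D ↔ D = GuttStar.guttStar K z) ∧
    (∀ (k : ℕ) (ξ η : g),
      GuttStar.guttStar K z (SymmetricAlgebra.ι K g ξ ^ k) (SymmetricAlgebra.ι K g η) =
        ∑ j ∈ Finset.range (k + 1),
          ((k.choose j : K) * z ^ j * ((bernoulli' j : ℚ) : K)) •
            (SymmetricAlgebra.ι K g ξ ^ (k - j) *
              SymmetricAlgebra.ι K g ((LieAlgebra.ad K g ξ ^ j) η))) :=
  ⟨GuttStar.quant_bijective K, GuttStar.quantRescaled_bijective K z,
    fun _ _ => by rw [GuttStar.guttStar_eq_pbwStar], GuttStar.isDrinfeldStar_iff K z,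
    fun k ξ η => GuttStar.guttStar_pow_ι z k ξ η⟩
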